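/- Let $k$ be a field, let $q\in k$ be nonzero and not a root of unity, and let $n\ge 0$ be an integer. Let $\mathcal O_q(M_n(k))$ be the $k$-algebra with generators $X_{ij}$ ($1\le i,j\le n$) and relations $$X_{ij}X_{lj}=qX_{lj}X_{ij}\ (i<l),\qquad X_{ij}X_{im}=qX_{im}X_{ij}\ (j<m),$$ $$X_{ij}X_{lm}=X_{lm}X_{ij}\ (i<l,\ j>m),\qquad X_{ij}X_{lm}-X_{lm}X_{ij}=(q-q^{-1})X_{im}X_{lj}\ (i<l,\ j<m),$$ let $D_q=\sum_{\sigma\in S_n}(-q)^{\ell(\sigma)}X_{1,\sigma(1)}X_{2,\sigma(2)}\cdots X_{n,\sigma(n)}$ be the quantum determinant, where $\ell(\sigma)$ is the minimum length of an expression for $\sigma$ as a product of simple transpositions, and put $$\mathcal O_q(GL_n(k))=\mathcal O_q(M_n(k))[D_q^{-1}],\qquad \mathcal O_q(SL_n(k))=\mathcal O_q(M_n(k))/\langle D_q-1\rangle .$$ Let $\pi:\mathcal O_q(GL_n(k))\to\mathcal O_q(SL_n(k))$ be the extension of the quotient map $\mathcal O_q(M_n(k))\to\mathcal O_q(SL_n(k))$.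 The torus $H=(k^\times)^{2n}$ acts on $\mathcal O_q(GL_n(k))$ by $k$-algebra automorphisms with $(\alpha_1,\dots,\alpha_n,\beta_1,\dots,\beta_n).X_{ij}=\alpha_i\beta_jX_{ij}$, and the analogous formula gives an action of the subgroup $SH=\{(\alpha,\beta)\in H\mid \alpha_1\cdots\alpha_n\beta_1\cdots\beta_n=1\}$ on $\mathcal O_q(SL_n(k))$. For a group $G$ acting on a ring by automorphisms, a $G$-prime ideal is a proper $G$-stable two-sided ideal $P$ such that, for all $G$-stable two-sided ideals $I,J$ with $IJ\subseteq P$, one has $I\subseteq P$ or $J\subseteq P$; a prime ideal is a proper two-sided ideal with this property for all two-sided ideals $I,J$. Proposition. The map $P\mapsto\pi(P)$ is a bijection from the set of $H$-prime ideals of $\mathcal O_q(GL_n(k))$ onto the set of $SH$-prime ideals of $\mathcal O_q(SL_n(k))$. Likewise, it is a bijection from the set of $H$-stable prime ideals of $\mathcal O_q(GL_n(k))$ onto the set of $SH$-stable prime ideals of $\mathcal O_q(SL_n(k))$. -/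

import Mathlib

namespace QuantumMatrix

section QuantumMatrices

variable {k : Type*} [Field k] {n : ℕ} {R S : Type*} [Ring R] [Algebra k R] [Ring S] [Algebra k S]

/-- The length of a permutation: the minimum length of an expression as a product of simple
transpositions `(i, i + 1)`. -/
noncomputable def permLength {n : ℕ} (σ : Equiv.Perm (Fin n)) : ℕ :=
  sInf {m : ℕ | ∃ l : List (Equiv.Perm (Fin n)),
    (∀ s ∈ l, ∃ i j : Fin n, (j : ℕ) = (i : ℕ) + 1 ∧ s = Equiv.swap i j) ∧
      l.prod = σ ∧ l.length = m}

/-- The quantum determinant of a matrix of elements of a `k`-algebra: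
the sum over all `σ` of `(-q) ^ ℓ(σ) X_{1,σ(1)} X_{2,σ(2)} ⋯ X_{n,σ(n)}`, factors in this order. -/
noncomputable def qdet (q : k) (X : Fin n → Fin n → R) : R :=
  ∑ σ : Equiv.Perm (Fin n), ((-q) ^ permLength σ) • (List.ofFn fun i => X i (σ i)).prod

/-- The defining relations of quantum matrices, for a matrix of elements of a `k`-algebra. -/
inductive MRel (q : k) (X : Fin n → Fin n → R) : R → R → Prop
  | col (i l j : Fin n) (hil : i < l) : MRel q X (X i j * X l j) (q • (X l j * X i j))
  | row (i j m : Fin n) (hjm : j < m) : MRel q X (X i j * X i m) (q • (X i m * X i j))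
  | anti (i l j m : Fin n) (hil : i < l) (hmj : m < j) :
      MRel q X (X i j * X l m) (X l m * X i j)
  | diag (i l j m : Fin n) (hil : i < l) (hjm : j < m) :
      MRel q X (X i j * X l m - X l m * X i j) ((q - q⁻¹) • (X i m * X l j))

lemma MRel.map_eq {q : k} {X : Fin n → Fin n → R} {Y : Fin n → Fin n → S} (f : R →ₐ[k] S)
    (hf : ∀ i j, f (X i j) = Y i j) (hY : ∀ a b, MRel q Y a b → a = b) {a b : R}
    (h : MRel q X a b) : f a = f b := by
  cases h with
  | col i l j hil => simpa [hf] using hY _ _ (MRel.col i l j hil)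
  | row i j m hjm => simpa [hf] using hY _ _ (MRel.row i j m hjm)
  | anti i l j m hil hmj => simpa [hf] using hY _ _ (MRel.anti i l j m hil hmj)
  | diag i l j m hil hjm => simpa [hf] using hY _ _ (MRel.diag i l j m hil hjm)

lemma MRel.eq_of_map {q : k} {X : Fin n → Fin n → R} (f : R →ₐ[k] S)
    (hX : ∀ a b, MRel q X a b → f a = f b) (a b : S)
    (h : MRel q (fun i j => f (X i j)) a b) : a = b := by
  cases h with
  | col i l j hil => simpa using hX _ _ (MRel.col i l j hil)
  | row i j m hjm => simpa using hX _ _ (MRel.row i j m hjm)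
  | anti i l j m hil hmj => simpa using hX _ _ (MRel.anti i l j m hil hmj)
  | diag i l j m hil hjm => simpa using hX _ _ (MRel.diag i l j m hil hjm)

lemma MRel.scale_eq {q : k} {X : Fin n → Fin n → R} (hX : ∀ a b, MRel q X a b → a = b)
    (α β : Fin n → k) (a b : R) (h : MRel q (fun i j => (α i * β j) • X i j) a b) : a = b := by
  cases h with
  | col i l j hil =>
    have := hX _ _ (MRel.col i l j hil)
    simp only [smul_mul_smul_comm, this, smul_smul]
    congr 1; ring
  | row i j m hjm =>
    have := hX _ _ (MRel.row i j m hjm)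
    simp only [smul_mul_smul_comm, this, smul_smul]
    congr 1; ring
  | anti i l j m hil hmj =>
    have := hX _ _ (MRel.anti i l j m hil hmj)
    simp only [smul_mul_smul_comm, this]
    congr 1; ring
  | diag i l j m hil hjm =>
    have := hX _ _ (MRel.diag i l j m hil hjm)
    simp only [smul_mul_smul_comm]
    rw [mul_comm (α l * β m) (α i * β j), ← smul_sub, this, smul_smul, smul_smul]
    congr 1; ring

lemma map_qdet (q : k) (X : Fin n → Fin n → R) (f : R →ₐ[k] S) :
    f (qdet q X) = qdet q (fun i j => f (X i j)) := by
  simp only [qdet, map_sum, map_smul, map_list_prod, List.map_ofFn]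
  rfl

lemma prod_ofFn_smul : ∀ {m : ℕ} (c : Fin m → k) (Y : Fin m → R),
    (List.ofFn fun i => c i • Y i).prod = (∏ i, c i) • (List.ofFn Y).prod
  | 0, _, _ => by simp
  | m + 1, c, Y => by
    simp only [List.ofFn_succ, List.prod_cons, Fin.prod_univ_succ]
    rw [prod_ofFn_smul, smul_mul_smul_comm]

lemma qdet_scale (q : k) (X : Fin n → Fin n → R) (α β : Fin n → k) :
    qdet q (fun i j => (α i * β j) • X i j) = ((∏ i, α i) * ∏ j, β j) • qdet q X := by
  simp only [qdet, Finset.smul_sum]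
  refine Finset.sum_congr rfl fun σ _ => ?_
  rw [prod_ofFn_smul (fun i => α i * β (σ i)) (fun i => X i (σ i)), Finset.prod_mul_distrib,
    Equiv.prod_comp σ β, smul_smul, smul_smul, mul_comm]

end QuantumMatrices

section Algebras

variable {k : Type*} [Field k] {n : ℕ} {q : k} {R : Type*} [Ring R] [Algebra k R]

/-- The quantized coordinate ring of `n × n` matrices. -/
def OqM (n : ℕ) {k : Type*} [Field k] (q : k) : Type _ :=
  RingQuot (MRel q fun i j : Fin n => FreeAlgebra.ι k (i, j))

noncomputable instance {n : ℕ} {k : Type*} [Field k] (q : k) : Ring (OqM n q) :=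
  inferInstanceAs (Ring (RingQuot _))

noncomputable instance {n : ℕ} {k : Type*} [Field k] (q : k) : Algebra k (OqM n q) :=
  inferInstanceAs (Algebra k (RingQuot _))

/-- The generators `X_{ij}` of the quantized coordinate ring of matrices. -/
noncomputable def OqM.X (q : k) (i j : Fin n) : OqM n q :=
  RingQuot.mkAlgHom k (MRel q fun i j : Fin n => FreeAlgebra.ι k (i, j)) (FreeAlgebra.ι k (i, j))

/-- The quantum determinant `D_q`. -/
noncomputable def OqM.D (n : ℕ) (q : k) : OqM n q := qdet q (OqM.X q)

lemma OqM.X_rel (a b : OqM n q) (h : MRel q (OqM.X (n := n) q) a b) : a = b :=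
  MRel.eq_of_map (RingQuot.mkAlgHom k (MRel q fun i j : Fin n => FreeAlgebra.ι k (i, j)))
    (fun _ _ h => RingQuot.mkAlgHom_rel k h) a b h

/-- Algebra homomorphisms out of the quantized coordinate ring of matrices. -/
noncomputable def OqM.lift (Y : Fin n → Fin n → R) (hY : ∀ a b, MRel q Y a b → a = b) :
    OqM n q →ₐ[k] R :=
  RingQuot.liftAlgHom k ⟨FreeAlgebra.lift k fun p : Fin n × Fin n => Y p.1 p.2,
    fun _ _ h => h.map_eq _ (fun i j => by simp) hY⟩

@[simp] lemma OqM.lift_X (Y : Fin n → Fin n → R) (hY : ∀ a b, MRel q Y a b → a = b)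
    (i j : Fin n) : OqM.lift Y hY (OqM.X q i j) = Y i j := by
  exact (RingQuot.liftAlgHom_mkAlgHom_apply k _ _ _).trans (by simp)

lemma OqM.hom_ext {f g : OqM n q →ₐ[k] R} (h : ∀ i j, f (OqM.X q i j) = g (OqM.X q i j)) :
    f = g := by
  refine RingQuot.ringQuot_ext' k _ _ (FreeAlgebra.hom_ext (funext fun p => ?_))
  exact h p.1 p.2

/-- Relations of `OqGL`: those of quantum matrices for the generators `some (i, j)`, and the
generator `none` is a two-sided inverse of the quantum determinant. -/
inductive GLRel (n : ℕ) (q : k) : FreeAlgebra k (Option (Fin n × Fin n)) →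
    FreeAlgebra k (Option (Fin n × Fin n)) → Prop
  | mat (a b : FreeAlgebra k (Option (Fin n × Fin n)))
      (h : MRel q (fun i j : Fin n => FreeAlgebra.ι k (some (i, j))) a b) : GLRel n q a b
  | det_mul_inv :
      GLRel n q (qdet q (fun i j : Fin n => FreeAlgebra.ι k (some (i, j))) * FreeAlgebra.ι k none) 1
  | inv_mul_det :
      GLRel n q (FreeAlgebra.ι k none * qdet q (fun i j : Fin n => FreeAlgebra.ι k (some (i, j)))) 1

/-- The quantized coordinate ring of `GL_n`: the localization `OqM n q [D_q⁻¹]`, that is, the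
algebra obtained from `OqM n q` by universally adjoining a two-sided inverse of `D_q` (see
`OqGL.existsUnique_lift` for the universal property of the localization). -/
def OqGL (n : ℕ) {k : Type*} [Field k] (q : k) : Type _ := RingQuot (GLRel n q)

noncomputable instance {n : ℕ} {k : Type*} [Field k] (q : k) : Ring (OqGL n q) :=
  inferInstanceAs (Ring (RingQuot _))

noncomputable instance {n : ℕ} {k : Type*} [Field k] (q : k) : Algebra k (OqGL n q) :=
  inferInstanceAs (Algebra k (RingQuot _))

/-- The generators `X_{ij}` of the quantized coordinate ring of `GL_n`. -/
noncomputable def OqGL.X (q : k) (i j : Fin n) : OqGL n q :=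
  RingQuot.mkAlgHom k (GLRel n q) (FreeAlgebra.ι k (some (i, j)))

/-- The inverse of the quantum determinant in the quantized coordinate ring of `GL_n`. -/
noncomputable def OqGL.Dinv (n : ℕ) (q : k) : OqGL n q :=
  RingQuot.mkAlgHom k (GLRel n q) (FreeAlgebra.ι k none)

lemma OqGL.X_rel (a b : OqGL n q) (h : MRel q (OqGL.X (n := n) q) a b) : a = b :=
  MRel.eq_of_map (RingQuot.mkAlgHom k (GLRel n q))
    (fun _ _ h => RingQuot.mkAlgHom_rel k (GLRel.mat _ _ h)) a b h

lemma OqGL.det_mul_Dinv : qdet q (OqGL.X (n := n) q) * OqGL.Dinv n q = 1 := by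
  have := RingQuot.mkAlgHom_rel k (GLRel.det_mul_inv (n := n) (q := q))
  rwa [map_mul, map_one, map_qdet] at this

lemma OqGL.Dinv_mul_det : OqGL.Dinv n q * qdet q (OqGL.X (n := n) q) = 1 := by
  have := RingQuot.mkAlgHom_rel k (GLRel.inv_mul_det (n := n) (q := q))
  rwa [map_mul, map_one, map_qdet] at this

/-- Algebra homomorphisms out of the quantized coordinate ring of `GL_n`. -/
noncomputable def OqGL.lift (Y : Fin n → Fin n → R) (hY : ∀ a b, MRel q Y a b → a = b) (t : R)
    (h₁ : qdet q Y * t = 1) (h₂ : t * qdet q Y = 1) : OqGL n q →ₐ[k] R :=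
  RingQuot.liftAlgHom k ⟨FreeAlgebra.lift k fun o : Option (Fin n × Fin n) =>
      o.elim t fun p => Y p.1 p.2, by
    intro a b h
    cases h with
    | mat a b h => exact h.map_eq _ (fun i j => by simp) hY
    | det_mul_inv => simpa [map_qdet] using h₁
    | inv_mul_det => simpa [map_qdet] using h₂⟩

@[simp] lemma OqGL.lift_X (Y : Fin n → Fin n → R) (hY : ∀ a b, MRel q Y a b → a = b) (t : R)
    (h₁ : qdet q Y * t = 1) (h₂ : t * qdet q Y = 1) (i j : Fin n) :
    OqGL.lift Y hY t h₁ h₂ (OqGL.X q i j) = Y i j := by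
  exact (RingQuot.liftAlgHom_mkAlgHom_apply k _ _ _).trans (by simp)

@[simp] lemma OqGL.lift_Dinv (Y : Fin n → Fin n → R) (hY : ∀ a b, MRel q Y a b → a = b) (t : R)
    (h₁ : qdet q Y * t = 1) (h₂ : t * qdet q Y = 1) :
    OqGL.lift Y hY t h₁ h₂ (OqGL.Dinv n q) = t := by
  exact (RingQuot.liftAlgHom_mkAlgHom_apply k _ _ _).trans (by simp)

lemma OqGL.hom_ext {f g : OqGL n q →ₐ[k] R} (h : ∀ i j, f (OqGL.X q i j) = g (OqGL.X q i j)) :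
    f = g := by
  have hD : f (OqGL.Dinv n q) = g (OqGL.Dinv n q) := by
    have e₁ : f (OqGL.Dinv n q) * f (qdet q (OqGL.X q)) = 1 := by
      rw [← map_mul, OqGL.Dinv_mul_det, map_one]
    have e₂ : g (qdet q (OqGL.X q)) * g (OqGL.Dinv n q) = 1 := by
      rw [← map_mul, OqGL.det_mul_Dinv, map_one]
    have e₃ : f (qdet q (OqGL.X q)) = g (qdet q (OqGL.X q)) := by
      simp only [map_qdet, h]
    rw [e₃] at e₁
    exact left_inv_eq_right_inv e₁ e₂
  refine RingQuot.ringQuot_ext' k _ _ (FreeAlgebra.hom_ext (funext fun o => ?_))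
  rcases o with _ | p
  · exact hD
  · exact h p.1 p.2

/-- The localization map `OqM n q → OqGL n q`. -/
noncomputable def OqGL.ofM (n : ℕ) (q : k) : OqM n q →ₐ[k] OqGL n q :=
  OqM.lift (OqGL.X q) OqGL.X_rel

/-- The universal property of the localization of `OqM n q` at the powers of `D_q`. -/
lemma OqGL.existsUnique_lift (f : OqM n q →ₐ[k] R) (hf : IsUnit (f (OqM.D n q))) :
    ∃! g : OqGL n q →ₐ[k] R, g.comp (OqGL.ofM n q) = f := by
  obtain ⟨u, hu⟩ := hf
  rw [OqM.D, map_qdet] at hu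
  have hY : ∀ a b, MRel q (fun i j => f (OqM.X q i j)) a b → a = b :=
    MRel.eq_of_map f fun _ _ h => congrArg _ (OqM.X_rel _ _ h)
  refine ⟨OqGL.lift _ hY (↑u⁻¹ : R) (by rw [← hu]; simp) (by rw [← hu]; simp),
    OqM.hom_ext fun i j => by simp [OqGL.ofM], fun g hg => OqGL.hom_ext fun i j => ?_⟩
  rw [OqGL.lift_X, ← hg]
  simp [OqGL.ofM]

/-- The quantized coordinate ring of `SL_n`: the quotient of `OqM n q` by the two-sided ideal
generated by `D_q - 1`. -/
def OqSL (n : ℕ) {k : Type*} [Field k] (q : k) : Type _ :=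
  RingQuot fun a b : OqM n q => a = OqM.D n q ∧ b = 1

noncomputable instance {n : ℕ} {k : Type*} [Field k] (q : k) : Ring (OqSL n q) :=
  inferInstanceAs (Ring (RingQuot _))

noncomputable instance {n : ℕ} {k : Type*} [Field k] (q : k) : Algebra k (OqSL n q) :=
  inferInstanceAs (Algebra k (RingQuot _))

/-- The quotient map `OqM n q → OqSL n q`. -/
noncomputable def OqSL.mk (n : ℕ) (q : k) : OqM n q →ₐ[k] OqSL n q :=
  RingQuot.mkAlgHom k _

lemma OqSL.mk_surjective : Function.Surjective (OqSL.mk n q) :=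
  RingQuot.mkAlgHom_surjective k _

lemma OqSL.mk_D : OqSL.mk n q (OqM.D n q) = 1 := by
  have := RingQuot.mkAlgHom_rel k
    (s := fun a b : OqM n q => a = OqM.D n q ∧ b = 1) (x := OqM.D n q) (y := 1) ⟨rfl, rfl⟩
  rwa [map_one] at this

/-- The generators `x_{ij}` of the quantized coordinate ring of `SL_n`. -/
noncomputable def OqSL.x (q : k) (i j : Fin n) : OqSL n q := OqSL.mk n q (OqM.X q i j)

lemma OqSL.x_rel (a b : OqSL n q) (h : MRel q (OqSL.x (n := n) q) a b) : a = b :=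
  MRel.eq_of_map (OqSL.mk n q) (fun _ _ h => congrArg _ (OqM.X_rel _ _ h)) a b h

lemma OqSL.qdet_x : qdet q (OqSL.x (n := n) q) = 1 := by
  have := OqSL.mk_D (n := n) (q := q)
  rwa [OqM.D, map_qdet] at this

/-- Algebra homomorphisms out of the quantized coordinate ring of `SL_n`. -/
noncomputable def OqSL.lift (Y : Fin n → Fin n → R) (hY : ∀ a b, MRel q Y a b → a = b)
    (hdet : qdet q Y = 1) : OqSL n q →ₐ[k] R :=
  RingQuot.liftAlgHom k ⟨OqM.lift Y hY, by
    rintro a b ⟨rfl, rfl⟩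
    simpa [OqM.D, map_qdet] using hdet⟩

@[simp] lemma OqSL.lift_x (Y : Fin n → Fin n → R) (hY : ∀ a b, MRel q Y a b → a = b)
    (hdet : qdet q Y = 1) (i j : Fin n) : OqSL.lift Y hY hdet (OqSL.x q i j) = Y i j := by
  exact (RingQuot.liftAlgHom_mkAlgHom_apply k _ _ _).trans (OqM.lift_X _ hY i j)

lemma OqSL.hom_ext {f g : OqSL n q →ₐ[k] R} (h : ∀ i j, f (OqSL.x q i j) = g (OqSL.x q i j)) :
    f = g :=
  RingQuot.ringQuot_ext' k _ _ (OqM.hom_ext h)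

/-- The extension `π : OqGL n q → OqSL n q` of the quotient map `OqM n q → OqSL n q`
(see `OqGL.toSL_comp_ofM`). -/
noncomputable def OqGL.toSL (n : ℕ) (q : k) : OqGL n q →ₐ[k] OqSL n q :=
  OqGL.lift (OqSL.x q) OqSL.x_rel 1 (by rw [OqSL.qdet_x, one_mul]) (by rw [OqSL.qdet_x, one_mul])

lemma OqGL.toSL_comp_ofM : (OqGL.toSL n q).comp (OqGL.ofM n q) = OqSL.mk n q :=
  OqM.hom_ext fun i j => by simp [OqGL.toSL, OqGL.ofM, OqSL.x]

lemma OqGL.toSL_surjective : Function.Surjective (OqGL.toSL n q) := by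
  intro b
  obtain ⟨a, rfl⟩ := OqSL.mk_surjective b
  exact ⟨OqGL.ofM n q a, by rw [← OqGL.toSL_comp_ofM]; rfl⟩

/-- The image `π(P)` of an ideal of `OqGL n q`, which is an ideal because `π` is surjective. -/
noncomputable def OqGL.imageIdeal (P : TwoSidedIdeal (OqGL n q)) : TwoSidedIdeal (OqSL n q) :=
  TwoSidedIdeal.mk' (OqGL.toSL n q '' (P : Set (OqGL n q)))
    ⟨0, P.zero_mem, map_zero _⟩
    (by
      rintro _ _ ⟨a, ha, rfl⟩ ⟨b, hb, rfl⟩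
      exact ⟨a + b, P.add_mem ha hb, map_add _ _ _⟩)
    (by
      rintro _ ⟨a, ha, rfl⟩
      exact ⟨-a, P.neg_mem ha, map_neg _ _⟩)
    (by
      rintro x _ ⟨a, ha, rfl⟩
      obtain ⟨y, rfl⟩ := OqGL.toSL_surjective x
      exact ⟨y * a, P.mul_mem_left _ _ ha, map_mul _ _ _⟩)
    (by
      rintro _ x ⟨a, ha, rfl⟩
      obtain ⟨y, rfl⟩ := OqGL.toSL_surjective x
      exact ⟨a * y, P.mul_mem_right _ _ ha, map_mul _ _ _⟩)

lemma OqGL.mem_imageIdeal (P : TwoSidedIdeal (OqGL n q)) (b : OqSL n q) :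
    b ∈ OqGL.imageIdeal P ↔ ∃ a ∈ P, OqGL.toSL n q a = b :=
  TwoSidedIdeal.mem_mk' _ _ _ _ _ _ _

end Algebras

section Torus

variable {k : Type*} [Field k] {n : ℕ} {q : k}

/-- The torus `H = (kˣ)²ⁿ`, with elements `(α, β)`. -/
abbrev H (n : ℕ) (k : Type*) [Field k] : Type _ := (Fin n → kˣ) × (Fin n → kˣ)

/-- The character `(α, β) ↦ α₁ ⋯ αₙ β₁ ⋯ βₙ` of `H`. -/
def detChar (n : ℕ) (k : Type*) [Field k] : H n k →* kˣ where
  toFun h := (∏ i, h.1 i) * ∏ j, h.2 j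
  map_one' := by simp
  map_mul' a b := by
    simp only [Prod.fst_mul, Prod.snd_mul, Pi.mul_apply, Finset.prod_mul_distrib]
    exact mul_mul_mul_comm _ _ _ _

/-- The subgroup `SH` of all `(α, β)` in `H` with `α₁ ⋯ αₙ β₁ ⋯ βₙ = 1`. -/
def SH (n : ℕ) (k : Type*) [Field k] : Subgroup (H n k) := (detChar n k).ker

lemma qdet_torus {R : Type*} [Ring R] [Algebra k R] (X : Fin n → Fin n → R) (h : H n k) :
    qdet q (fun i j => ((h.1 i : k) * (h.2 j : k)) • X i j) = (detChar n k h : k) • qdet q X := by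
  rw [qdet_scale q X (fun i => (h.1 i : k)) (fun j => (h.2 j : k))]
  simp [detChar]

/-- The endomorphism of `OqGL n q` with `X_{ij} ↦ αᵢ βⱼ X_{ij}`. -/
noncomputable def OqGL.torusEnd (h : H n k) : OqGL n q →ₐ[k] OqGL n q :=
  OqGL.lift (fun i j => ((h.1 i : k) * (h.2 j : k)) • OqGL.X q i j)
    (MRel.scale_eq OqGL.X_rel _ _)
    ((detChar n k h : k)⁻¹ • OqGL.Dinv n q)
    (by rw [qdet_torus, smul_mul_smul_comm, OqGL.det_mul_Dinv]; simp)
    (by rw [qdet_torus, smul_mul_smul_comm, OqGL.Dinv_mul_det]; simp)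

/-- The endomorphism of `OqSL n q` with `x_{ij} ↦ αᵢ βⱼ x_{ij}`. -/
noncomputable def OqSL.torusEnd (h : SH n k) : OqSL n q →ₐ[k] OqSL n q :=
  OqSL.lift (fun i j => ((h.1.1 i : k) * (h.1.2 j : k)) • OqSL.x q i j)
    (MRel.scale_eq OqSL.x_rel _ _)
    (by rw [qdet_torus, OqSL.qdet_x, MonoidHom.mem_ker.mp h.2]; simp)

/-- The action of `H` on `OqGL n q` by `k`-algebra automorphisms. -/
noncomputable def OqGL.torusAction (n : ℕ) (q : k) : H n k →* (OqGL n q ≃ₐ[k] OqGL n q) :=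
  (AlgEquiv.algHomUnitsEquiv k (OqGL n q)).toMonoidHom.comp <| MonoidHom.toHomUnits
    { toFun := OqGL.torusEnd
      map_one' := OqGL.hom_ext fun i j => by simp [OqGL.torusEnd]
      map_mul' := fun g h => OqGL.hom_ext fun i j => by
        simp only [OqGL.torusEnd, AlgHom.mul_apply, OqGL.lift_X, map_smul, smul_smul,
          Prod.fst_mul, Prod.snd_mul, Pi.mul_apply, Units.val_mul]
        congr 1; ring }

/-- The action of `SH` on `OqSL n q` by `k`-algebra automorphisms. -/
noncomputable def OqSL.torusAction (n : ℕ) (q : k) : SH n k →* (OqSL n q ≃ₐ[k] OqSL n q) :=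
  (AlgEquiv.algHomUnitsEquiv k (OqSL n q)).toMonoidHom.comp <| MonoidHom.toHomUnits
    { toFun := OqSL.torusEnd
      map_one' := OqSL.hom_ext fun i j => by simp [OqSL.torusEnd]
      map_mul' := fun g h => OqSL.hom_ext fun i j => by
        simp only [OqSL.torusEnd, AlgHom.mul_apply, OqSL.lift_x, map_smul, smul_smul,
          Subgroup.coe_mul, Prod.fst_mul, Prod.snd_mul, Pi.mul_apply, Units.val_mul]
        congr 1; ring }

lemma OqGL.torusAction_X (h : H n k) (i j : Fin n) :
    OqGL.torusAction n q h (OqGL.X q i j) = ((h.1 i : k) * (h.2 j : k)) • OqGL.X q i j := by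
  change OqGL.torusEnd h (OqGL.X q i j) = _
  simp [OqGL.torusEnd]

lemma OqSL.torusAction_x (h : SH n k) (i j : Fin n) :
    OqSL.torusAction n q h (OqSL.x q i j) = ((h.1.1 i : k) * (h.1.2 j : k)) • OqSL.x q i j := by
  change OqSL.torusEnd h (OqSL.x q i j) = _
  simp [OqSL.torusEnd]

end Torus

section Primes

variable {k : Type*} [Field k] {A : Type*} [Ring A] [Algebra k A] {G : Type*} [Group G]

/-- An ideal is stable under a group acting by algebra automorphisms. -/
def IsStable (φ : G →* (A ≃ₐ[k] A)) (I : TwoSidedIdeal A) : Prop :=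
  ∀ g : G, ∀ a ∈ I, φ g a ∈ I

/-- A prime ideal of a not necessarily commutative ring: a proper ideal `P` such that, for all
ideals `I` and `J` with `I J ⊆ P`, one of `I`, `J` is contained in `P`. -/
structure IsPrimeIdeal (P : TwoSidedIdeal A) : Prop where
  ne_top : P ≠ ⊤
  le_or_le : ∀ I J : TwoSidedIdeal A, (∀ a ∈ I, ∀ b ∈ J, a * b ∈ P) → I ≤ P ∨ J ≤ P

/-- A `G`-prime ideal: a proper `G`-stable ideal `P` such that, for all `G`-stable
ideals `I` and `J` with `I J ⊆ P`, one of `I`, `J` is contained in `P`. -/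
structure IsGPrime (φ : G →* (A ≃ₐ[k] A)) (P : TwoSidedIdeal A) : Prop where
  ne_top : P ≠ ⊤
  stable : IsStable φ P
  le_or_le : ∀ I J : TwoSidedIdeal A, IsStable φ I → IsStable φ J →
    (∀ a ∈ I, ∀ b ∈ J, a * b ∈ P) → I ≤ P ∨ J ≤ P

end Primes

end QuantumMatrix

/-! The point is that $\mathcal O_q(GL_n)$ is a Laurent polynomial ring over $\mathcal O_q(SL_n)$ in
the central variable $D_q$. For $n\ge 1$, multiplying the first row of the generic matrix by
$D_q^{-1}$ gives a quantum matrix of determinant 1, hence an embedding $s$ of $\mathcal O_q(SL_n)$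
with $\pi s=\mathrm{id}$ (`OqSL.toGL`); multiplying the first row by the variable gives the
comparison in the other direction (`OqGL.splitting`).

In these coordinates $\pi$ sets the variable equal to 1. Every $h\in H$ is an element of $SH$ times
a scaling of the first row; the former fixes $D_q$, the latter fixes $s(\mathcal O_q(SL_n))$
pointwise and rescales $D_q$ (`OqGL.torusAction_toGL`). Scaling by $q$, which has infinite order,
separates the powers of $D_q$, so an $H$-stable ideal is homogeneous
(`LaurentSplitting.s_coeff_mem`). It therefore consists of the Laurent polynomials with coefficients
in an $SH$-stable ideal $Q$, and $Q=\pi(P)=s^{-1}(P)$. This bijection of stable ideals respects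
products, which settles $G$-primes; for primes, a leading coefficient argument shows that $Q$ prime
makes its extension prime (`LaurentSplitting.isPrimeIdeal_extend`).

All of this needs $D_q$ to be central (`qdet_commute`). Quantum minors are defined as coefficients
of products of transformed generators of a quantum exterior algebra, which yields row expansions
with the minors on either side. Column expansions follow because minors are invariant under
transposition, proved by comparing signed double sums and cancelling a $q^2$-factorial. A row and a
column expansion then evaluate one double sum as both $X_{ab}D_q$ and $D_qX_{ab}$. -/

namespace QuantumMatrix

/-! ### Inversions of words, length of permutations, and $q$-signs -/

section Words

open Finset

variable {k : Type*} [Field k] {m n : ℕ}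

/-- The number of inversions of a word. -/
def invNum (f : Fin m → Fin n) : ℕ :=
  #{p : Fin m × Fin m | p.1 < p.2 ∧ f p.2 < f p.1}

lemma invNum_eq_sum (f : Fin m → Fin n) :
    invNum f = ∑ a, ∑ b, if a < b ∧ f b < f a then 1 else 0 := by
  rw [invNum, Finset.card_filter, ← Finset.univ_product_univ, Finset.sum_product]

lemma invNum_cons (c : Fin n) (g : Fin m → Fin n) :
    invNum (Fin.cons c g : Fin (m + 1) → Fin n) = #{b | g b < c} + invNum g := by
  simp [invNum_eq_sum, Fin.sum_univ_succ, Finset.card_filter, -Finset.sum_boole]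

lemma invNum_snoc (c : Fin n) (g : Fin m → Fin n) :
    invNum (Fin.snoc g c : Fin (m + 1) → Fin n) = #{b | c < g b} + invNum g := by
  simp [invNum_eq_sum, Fin.sum_univ_castSucc, Finset.card_filter, Finset.sum_add_distrib,
    Fin.castSucc_lt_last, add_comm, Fin.not_lt.mpr (Fin.le_last _), -Finset.sum_boole]

lemma swap_lt_swap {i j a b : Fin m} (hij : (j : ℕ) = i + 1) (hab : a < b)
    (h : ¬(a = i ∧ b = j)) : Equiv.swap i j a < Equiv.swap i j b := by
  simp only [Equiv.swap_apply_def, Fin.lt_def, Fin.ext_iff] at *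
  split_ifs <;> omega

/-- The adjacent transposition carries the inversions of `f` to inversions of the new word, and
exactly one is added: the pair $(i,j)$ itself. -/
lemma invNum_comp_swap {f : Fin m → Fin n} {i j : Fin m} (hij : (j : ℕ) = i + 1)
    (h : f i < f j) : invNum (f ∘ Equiv.swap i j) = invNum f + 1 := by
  have hlt : i < j := by rw [Fin.lt_def]; omega
  have key : (univ.filter fun p : Fin m × Fin m =>
      p.1 < p.2 ∧ (f ∘ Equiv.swap i j) p.2 < (f ∘ Equiv.swap i j) p.1) =
      insert (i, j) ((univ.filter fun p : Fin m × Fin m => p.1 < p.2 ∧ f p.2 < f p.1).map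
        ((Equiv.swap i j).prodCongr (Equiv.swap i j)).toEmbedding) := by
    ext ⟨a, b⟩
    simp only [mem_filter, mem_univ, true_and, Function.comp_apply, mem_insert, mem_map_equiv,
      Equiv.prodCongr_symm, Equiv.prodCongr_apply, Prod.map_apply, Equiv.symm_swap, Prod.mk.injEq]
    constructor
    · rintro ⟨hab, hf⟩
      by_cases hc : a = i ∧ b = j
      · exact Or.inl hc
      · exact Or.inr ⟨swap_lt_swap hij hab hc, hf⟩
    · rintro (⟨rfl, rfl⟩ | ⟨hab, hf⟩)
      · simpa using ⟨hlt, h⟩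
      · refine ⟨?_, hf⟩
        have := swap_lt_swap hij hab (by
          rintro ⟨h1, h2⟩
          rw [h1, h2] at hf
          exact lt_asymm h hf)
        simpa using this
  rw [invNum, key, Finset.card_insert_of_notMem, Finset.card_map, invNum]
  simp only [mem_map_equiv, Equiv.prodCongr_symm, Equiv.prodCongr_apply, Prod.map_apply,
    Equiv.symm_swap, mem_filter, Equiv.swap_apply_left, Equiv.swap_apply_right]
  exact fun h' => lt_asymm hlt h'.2.1

lemma invNum_comp_swap_of_gt {f : Fin m → Fin n} {i j : Fin m} (hij : (j : ℕ) = i + 1)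
    (h : f j < f i) : invNum (f ∘ Equiv.swap i j) + 1 = invNum f := by
  have := invNum_comp_swap (f := f ∘ Equiv.swap i j) hij (by simpa using h)
  rw [← this]
  congr 1
  ext x
  simp

lemma invNum_id : invNum (id : Fin m → Fin m) = 0 := by
  simp only [invNum, Finset.card_eq_zero, Finset.filter_eq_empty_iff]
  exact fun _ _ h => lt_asymm h.1 h.2

lemma invNum_list_prod_le (l : List (Equiv.Perm (Fin m)))
    (hl : ∀ s ∈ l, ∃ i j : Fin m, (j : ℕ) = (i : ℕ) + 1 ∧ s = Equiv.swap i j) :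
    invNum (l.prod : Equiv.Perm (Fin m)) ≤ l.length := by
  induction l using List.reverseRecOn with
  | nil => exact invNum_id.le
  | append_singleton l s ih =>
    obtain ⟨i, j, hij, rfl⟩ := hl s (by simp)
    have ih := ih fun t ht => hl t (by simp [ht])
    rw [List.prod_append, List.prod_singleton, Equiv.Perm.coe_mul, List.length_append,
      List.length_singleton]
    have hne : i ≠ j := by rintro rfl; omega
    rcases lt_or_gt_of_ne (l.prod.injective.ne hne) with h | h
    · rw [invNum_comp_swap hij h]; omega
    · have := invNum_comp_swap_of_gt hij h; omega

/-- A permutation without descents is increasing, and the identity is the only order automorphism of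
a finite chain. -/
lemma exists_descent {σ : Equiv.Perm (Fin m)} (hσ : σ ≠ 1) :
    ∃ i j : Fin m, (j : ℕ) = i + 1 ∧ σ j < σ i := by
  by_contra! h
  apply hσ
  obtain _ | m := m
  · exact Subsingleton.elim _ _
  have hm : StrictMono σ := Fin.strictMono_iff_lt_succ.mpr fun i =>
    lt_of_le_of_ne (h i.castSucc i.succ (by simp)) (σ.injective.ne (Fin.castSucc_lt_succ).ne)
  have := Subsingleton.elim (hm.orderIsoOfSurjective _ σ.surjective) (OrderIso.refl _)
  ext x
  have := congrArg (fun e : Fin (m + 1) ≃o Fin (m + 1) => (e x : ℕ)) this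
  simpa using this

lemma exists_list_prod (σ : Equiv.Perm (Fin m)) : ∃ l : List (Equiv.Perm (Fin m)),
    (∀ s ∈ l, ∃ i j : Fin m, (j : ℕ) = (i : ℕ) + 1 ∧ s = Equiv.swap i j) ∧
      l.prod = σ ∧ l.length = invNum σ := by
  induction hN : invNum σ using Nat.strong_induction_on generalizing σ with
  | _ N ih =>
    by_cases hσ : σ = 1
    · subst hσ
      exact ⟨[], by simp, by simp, by rw [← hN]; exact invNum_id.symm⟩
    · obtain ⟨i, j, hij, hlt⟩ := exists_descent hσ
      have h1 := invNum_comp_swap_of_gt hij hlt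
      obtain ⟨l, hl, hp, hlen⟩ := ih (invNum (σ ∘ Equiv.swap i j)) (by omega)
        (σ * Equiv.swap i j) rfl
      refine ⟨l ++ [Equiv.swap i j], ?_, ?_, ?_⟩
      · intro s hs
        rcases List.mem_append.mp hs with h | h
        · exact hl s h
        · exact ⟨i, j, hij, by simpa using h⟩
      · rw [List.prod_append, hp, List.prod_singleton, mul_assoc, Equiv.swap_mul_self, mul_one]
      · rw [List.length_append, hlen, List.length_singleton]; omega

/-- Inversions, unlike minimal expressions, can be counted letter by letter and make sense for all
words, as the expansions of minors require. -/
lemma permLength_eq_invNum (σ : Equiv.Perm (Fin m)) : permLength σ = invNum σ := by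
  apply le_antisymm
  · exact Nat.sInf_le (exists_list_prod σ)
  · obtain ⟨l, hl, hp, hlen⟩ := Nat.sInf_mem (⟨_, exists_list_prod σ⟩ : {N : ℕ |
      ∃ l : List (Equiv.Perm (Fin m)),
        (∀ s ∈ l, ∃ i j : Fin m, (j : ℕ) = (i : ℕ) + 1 ∧ s = Equiv.swap i j) ∧
          l.prod = σ ∧ l.length = N}.Nonempty)
    have := invNum_list_prod_le l hl
    rw [hp, hlen] at this
    exact this

/-- The `q`-sign of a word: `(-q) ^ inv` for words without repetition, and `0` for others. -/
noncomputable def qsign (q : k) (f : Fin m → Fin n) : k :=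
  open Classical in if Function.Injective f then (-q) ^ invNum f else 0

lemma qsign_of_injective (q : k) {f : Fin m → Fin n} (hf : Function.Injective f) :
    qsign q f = (-q) ^ invNum f := if_pos hf

lemma qsign_of_not_injective (q : k) {f : Fin m → Fin n} (hf : ¬ Function.Injective f) :
    qsign q f = 0 := if_neg hf

lemma card_filter_image {g : Fin m → Fin n} (hg : Function.Injective g) (p : Fin n → Prop)
    [DecidablePred p] : #{b | p (g b)} = #{t ∈ univ.image g | p t} := by
  rw [Finset.filter_image, Finset.card_image_of_injective _ hg]

/-- A letter put in front forms inversions exactly with the smaller letters, so the new factor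
depends only on the set of letters of `g`. -/
lemma qsign_cons (q : k) (c : Fin n) (g : Fin m → Fin n) :
    qsign q (Fin.cons c g : Fin (m + 1) → Fin n) =
      if c ∈ univ.image g then 0 else (-q) ^ #{t ∈ univ.image g | t < c} * qsign q g := by
  have hinj : Function.Injective (Fin.cons c g : Fin (m + 1) → Fin n) ↔
      c ∉ univ.image g ∧ Function.Injective g := by
    rw [Fin.cons_injective_iff]; simp
  by_cases hg : Function.Injective g
  · split_ifs with hc
    · exact qsign_of_not_injective _ (by tauto)
    · rw [qsign_of_injective _ (hinj.mpr ⟨hc, hg⟩), qsign_of_injective _ hg, invNum_cons,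
        pow_add, card_filter_image hg fun t => t < c]
  · rw [qsign_of_not_injective q (by tauto), qsign_of_not_injective q hg]
    simp

lemma qsign_snoc (q : k) (c : Fin n) (g : Fin m → Fin n) :
    qsign q (Fin.snoc g c : Fin (m + 1) → Fin n) =
      if c ∈ univ.image g then 0 else (-q) ^ #{t ∈ univ.image g | c < t} * qsign q g := by
  have hinj : Function.Injective (Fin.snoc g c : Fin (m + 1) → Fin n) ↔
      c ∉ univ.image g ∧ Function.Injective g := by
    rw [Fin.snoc_injective_iff]; simp [and_comm]
  by_cases hg : Function.Injective g
  · split_ifs with hc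
    · exact qsign_of_not_injective _ (by tauto)
    · rw [qsign_of_injective _ (hinj.mpr ⟨hc, hg⟩), qsign_of_injective _ hg, invNum_snoc,
        pow_add, card_filter_image hg fun t => c < t]
  · rw [qsign_of_not_injective q (by tauto), qsign_of_not_injective q hg]
    simp

lemma qsign_of_strictMono (q : k) {f : Fin m → Fin n} (hf : StrictMono f) : qsign q f = 1 := by
  have : invNum f = 0 := by
    simp only [invNum, Finset.card_eq_zero, Finset.filter_eq_empty_iff]
    exact fun _ _ h => lt_asymm (hf h.1) h.2
  rw [qsign_of_injective _ hf.injective, this, pow_zero]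

lemma qsign_mul_self (q : k) (f : Fin m → Fin n) : qsign q f * qsign q f = qsign (-q ^ 2) f := by
  by_cases hf : Function.Injective f
  · simp only [qsign_of_injective _ hf, neg_neg, ← mul_pow]
    congr 1
    ring
  · simp [qsign_of_not_injective _ hf]

end Words

end QuantumMatrix

namespace QuantumMatrix

/-! ### Quantum exterior algebras -/

section Exterior

open Finset

variable {k : Type*} [Field k] {m n : ℕ} {q : k} {R : Type*} [Ring R] [Algebra k R]

lemma sum_fin_cons {M : Type*} [AddCommMonoid M] (F : (Fin (m + 1) → Fin n) → M) :
    ∑ f, F f = ∑ c, ∑ g : Fin m → Fin n, F (Fin.cons c g) := by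
  rw [← (Fin.consEquiv fun _ => Fin n).sum_comp, Fintype.sum_prod_type]
  rfl

lemma sum_fin_snoc {M : Type*} [AddCommMonoid M] (F : (Fin (m + 1) → Fin n) → M) :
    ∑ f, F f = ∑ c, ∑ g : Fin m → Fin n, F (Fin.snoc g c) := by
  rw [← (Fin.snocEquiv fun _ => Fin n).sum_comp, Fintype.sum_prod_type]
  rfl

lemma image_fin_cons (c : Fin n) (g : Fin m → Fin n) :
    univ.image (Fin.cons c g : Fin (m + 1) → Fin n) = insert c (univ.image g) := by
  ext t
  simp [Fin.exists_fin_succ, eq_comm]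

lemma image_fin_snoc (c : Fin n) (g : Fin m → Fin n) :
    univ.image (Fin.snoc g c : Fin (m + 1) → Fin n) = insert c (univ.image g) := by
  ext t
  simp [Fin.exists_iff_castSucc, eq_comm]

/-- The relations of the generators of a quantum exterior algebra. -/
structure IsQExterior (q : k) (y : Fin n → R) : Prop where
  mul_self : ∀ i, y i * y i = 0
  mul_of_lt : ∀ i j, i < j → y j * y i = (-q) • (y i * y j)

/-- The product of the `y i` with `i ∈ I`, in increasing order. -/
noncomputable def sortedProd (y : Fin n → R) (I : Finset (Fin n)) : R := (I.sort.map y).prod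

lemma sortedProd_insert (y : Fin n → R) {a : Fin n} {I : Finset (Fin n)} (h : ∀ b ∈ I, a < b) :
    sortedProd y (insert a I) = y a * sortedProd y I := by
  rw [sortedProd, Finset.sort_insert _ (fun b hb => (h b hb).le) fun ha => lt_irrefl _ (h a ha)]
  simp [sortedProd]

/-- Moving `y c` to its place past each smaller factor costs $-q$; if it meets its own copy, the
square kills the product. -/
lemma IsQExterior.mul_sortedProd {y : Fin n → R} (hy : IsQExterior q y) (c : Fin n)
    (I : Finset (Fin n)) : y c * sortedProd y I =
      (if c ∈ I then 0 else (-q) ^ #{t ∈ I | t < c}) • sortedProd y (insert c I) := by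
  induction I using Finset.induction_on_min with
  | empty => simp [sortedProd]
  | insert a I ha ih =>
    have haI : a ∉ I := fun h => lt_irrefl _ (ha a h)
    rw [sortedProd_insert y ha]
    rcases lt_trichotomy c a with hc | rfl | hc
    · have hcI : ∀ b ∈ insert a I, c < b := by
        intro b hb
        rcases mem_insert.mp hb with rfl | hb
        · exact hc
        · exact hc.trans (ha b hb)
      rw [if_neg fun h => lt_irrefl _ (hcI c h), sortedProd_insert y hcI,
        sortedProd_insert y ha, Finset.filter_eq_empty_iff.mpr fun t ht => (hcI t ht).not_gt]
      simp
    · rw [← mul_assoc, hy.mul_self]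
      simp
    · rw [← mul_assoc, hy.mul_of_lt a c hc, smul_mul_assoc, mul_assoc, ih]
      have h1 : c ∈ insert a I ↔ c ∈ I := by simp [hc.ne']
      simp only [h1]
      split_ifs with h
      · simp
      · rw [Finset.insert_comm, sortedProd_insert y (a := a), mul_smul_comm, smul_smul,
          Finset.filter_insert, if_pos hc, Finset.card_insert_of_notMem, pow_succ']
        · exact fun h' => haI (mem_filter.mp h').1
        · intro b hb
          rcases mem_insert.mp hb with rfl | hb
          · exact hc
          · exact ha b hb

lemma IsQExterior.prod_ofFn {y : Fin n → R} (hy : IsQExterior q y) (f : Fin m → Fin n) :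
    (List.ofFn fun a => y (f a)).prod = qsign q f • sortedProd y (univ.image f) := by
  induction m with
  | zero =>
    rw [qsign_of_injective q (Function.injective_of_subsingleton f)]
    simp [sortedProd, invNum]
  | succ m ih =>
    rw [← Fin.cons_self_tail f, image_fin_cons, qsign_cons, List.ofFn_succ, List.prod_cons]
    simp only [Fin.cons_zero, Fin.cons_succ]
    rw [ih, mul_smul_comm, hy.mul_sortedProd, smul_smul]
    split_ifs <;> simp [mul_comm]

/-- Quantum matrices act on the generators of a quantum exterior algebra. -/
lemma IsQExterior.matrix_mul {y : Fin n → R} (hy : IsQExterior q y) (hq : q ≠ 0)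
    {X : Fin n → Fin n → R} (hX : ∀ a b, MRel q X a b → a = b)
    (hc : ∀ i j l, Commute (X i j) (y l)) : IsQExterior q fun i => ∑ j, X i j * y j := by
  have expand : ∀ i l, (∑ j, X i j * y j) * (∑ j, X l j * y j) =
      ∑ p : Fin n × Fin n, X i p.1 * X l p.2 * (y p.1 * y p.2) := by
    intro i l
    rw [Finset.sum_mul_sum, Fintype.sum_prod_type]
    refine sum_congr rfl fun a _ => sum_congr rfl fun b _ => ?_
    rw [mul_assoc, ← mul_assoc (y a), ← (hc l b a).eq]
    simp only [mul_assoc]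
  -- Terms cancel in pairs $(a,b)$, $(b,a)$, and the diagonal vanishes because $y_a^2=0$.
  have vanish : ∀ F : Fin n × Fin n → R,
      (∀ a b, a < b → F (a, b) * (y a * y b) + F (b, a) * (y b * y a) = 0) →
      ∑ p, F p * (y p.1 * y p.2) = 0 := by
    intro F hF
    refine Finset.sum_involution (fun p _ => p.swap) ?_ ?_ (by simp) (by simp)
    · rintro ⟨a, b⟩ -
      rcases lt_trichotomy a b with h | rfl | h
      · exact hF a b h
      · simp [hy.mul_self]
      · rw [add_comm]; exact hF b a h
    · rintro ⟨a, b⟩ - h1 h2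
      obtain rfl : b = a := congrArg Prod.fst h2
      exact h1 (by simp [hy.mul_self])
  refine ⟨fun i => ?_, fun i l hil => ?_⟩
  · rw [expand]
    refine vanish (fun p => X i p.1 * X i p.2) fun a b hab => ?_
    dsimp only
    rw [hy.mul_of_lt a b hab, hX _ _ (MRel.row i a b hab), mul_smul_comm, smul_mul_assoc, neg_smul,
      add_neg_cancel]
  · rw [← sub_eq_zero, expand, expand, Finset.smul_sum, ← Finset.sum_sub_distrib]
    rw [← vanish (fun p => X l p.1 * X i p.2 - (-q) • (X i p.1 * X l p.2))]
    · exact sum_congr rfl fun p _ => by rw [sub_mul, smul_mul_assoc]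
    intro a b hab
    dsimp only
    have h1 := hX _ _ (MRel.anti i l b a hil hab)
    have h2 := sub_eq_iff_eq_add.mp (hX _ _ (MRel.diag i l a b hil hab))
    -- The terms in `X i a` and `X l b` cancel up to the diagonal relation, leaving `X i b * X l a`
    -- with coefficient $1+q(q-q^{-1})-q^2=0$.
    have h0 : X l a * X i b - (-q) • (X i a * X l b) +
        (-q) • (X l b * X i a - (-q) • (X i b * X l a)) = 0 := by
      rw [h2, ← h1]
      simp only [smul_sub, smul_add, smul_smul]
      match_scalars <;> field_simp <;> ring
    rw [hy.mul_of_lt a b hab, mul_smul_comm, ← smul_mul_assoc (-q) (_ - _), ← add_mul, h0,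
      zero_mul]

lemma prod_ofFn_sum {x : Fin n → Fin n → R} {y : Fin n → R}
    (hc : ∀ i j l, Commute (x i j) (y l)) (f : Fin m → Fin n) :
    (List.ofFn fun a => ∑ j, x (f a) j * y j).prod =
      ∑ g : Fin m → Fin n,
        (List.ofFn fun a => x (f a) (g a)).prod * (List.ofFn fun a => y (g a)).prod := by
  induction m with
  | zero => simp
  | succ m ih =>
    rw [List.ofFn_succ, List.prod_cons, ih fun a => f a.succ, Finset.sum_mul_sum, sum_fin_cons]
    refine sum_congr rfl fun c _ => sum_congr rfl fun g _ => ?_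
    simp only [List.ofFn_succ, List.prod_cons, Fin.cons_zero, Fin.cons_succ]
    have : Commute (y c) (List.ofFn fun a => x (f a.succ) (g a)).prod :=
      Commute.list_prod_right _ _ fun z hz => by
        obtain ⟨a, rfl⟩ := List.mem_ofFn.mp hz
        exact (hc _ _ _).symm
    rw [mul_assoc, ← mul_assoc (y c), this.eq]
    simp only [mul_assoc]

end Exterior

/-! ### Quantum minors from creation operators -/

section FockSpace

open Finset

variable {k : Type*} [Field k] {m n : ℕ} {q : k} {R : Type*} [Ring R] [Algebra k R]

/-- The creation operators of the quantum exterior algebra, with coefficients in `R`. -/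
def creation (q : k) (R : Type*) [Ring R] [Algebra k R] (j : Fin n) :
    Module.End k (Finset (Fin n) → R) where
  toFun v T := if j ∈ T then (-q) ^ #{t ∈ T | t < j} • v (T.erase j) else 0
  map_add' v w := by
    ext T
    simp only [Pi.add_apply]
    split_ifs <;> simp
  map_smul' c v := by
    ext T
    simp only [Pi.smul_apply, RingHom.id_apply]
    split_ifs
    · rw [smul_comm]
    · simp

lemma creation_apply (j : Fin n) (v : Finset (Fin n) → R) (T : Finset (Fin n)) :
    creation q R j v T = if j ∈ T then (-q) ^ #{t ∈ T | t < j} • v (T.erase j) else 0 := rfl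

lemma isQExterior_creation : IsQExterior q (creation (n := n) q R) := by
  refine ⟨fun i => ?_, fun i j hij => ?_⟩
  · ext v T
    simp [creation_apply]
  · refine LinearMap.ext fun v => funext fun T => ?_
    simp only [Module.End.mul_apply, LinearMap.smul_apply, Pi.smul_apply, creation_apply, mem_erase,
      ne_eq, hij.ne, hij.ne', not_false_eq_true, true_and]
    by_cases hi : i ∈ T <;> by_cases hj : j ∈ T <;> simp only [hi, hj, if_true, if_false, smul_zero]
    -- Since $i<j$, erasing $i$ lowers the exponent for $j$ by one, while erasing $j$ leaves the
    -- exponent for $i$ unchanged.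
    rw [Finset.erase_right_comm, smul_smul, smul_smul, smul_smul, Finset.filter_erase,
      Finset.filter_erase, Finset.erase_eq_of_notMem (s := {t ∈ T | t < i}) (by simp [hij.le]),
      ← Finset.card_erase_add_one (s := {t ∈ T | t < j}) (a := i) (by simp [hi, hij])]
    congr 1
    ring

/-- The vacuum vector. -/
noncomputable def vacuum (R : Type*) [Ring R] (n : ℕ) : Finset (Fin n) → R := Pi.single ∅ 1

/-- Ensures that sorted monomials are linearly independent: their coefficients can be read off from
the action on the vacuum. -/
lemma sortedProd_creation_vacuum (I : Finset (Fin n)) :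
    sortedProd (creation q R) I (vacuum R n) = Pi.single I 1 := by
  induction I using Finset.induction_on_min with
  | empty => simp [sortedProd, vacuum]
  | insert a I ha ih =>
    have haI : a ∉ I := fun h => lt_irrefl _ (ha a h)
    rw [sortedProd_insert _ ha, Module.End.mul_apply, ih]
    ext T
    rw [creation_apply]
    by_cases hT : T = insert a I
    · subst hT
      rw [if_pos (mem_insert_self _ _), Finset.erase_insert haI, Finset.filter_eq_empty_iff.mpr]
      · simp
      · intro t ht
        rcases mem_insert.mp ht with rfl | ht
        · exact lt_irrefl _
        · exact (ha t ht).not_gt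
    · rw [Pi.single_eq_of_ne hT]
      split_ifs with h
      · rw [Pi.single_eq_of_ne, smul_zero]
        rintro rfl
        exact hT (Finset.insert_erase h).symm
      · rfl

/-- Left multiplication on the Fock space. -/
noncomputable def leftMul (k : Type*) [Field k] (R : Type*) [Ring R] [Algebra k R] (n : ℕ) :
    R →ₐ[k] Module.End k (Finset (Fin n) → R) := Algebra.lsmul k k _

lemma leftMul_apply (a : R) (v : Finset (Fin n) → R) (T : Finset (Fin n)) :
    leftMul k R n a v T = a * v T := rfl

lemma commute_leftMul_creation (a : R) (j : Fin n) :
    Commute (leftMul k R n a) (creation q R j) := by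
  refine LinearMap.ext fun v => funext fun T => ?_
  simp only [Module.End.mul_apply, leftMul_apply, creation_apply]
  split_ifs <;> simp

/-- The creation operators transformed by a matrix. -/
noncomputable def matrixCreation (q : k) (X : Fin n → Fin n → R) (i : Fin n) :
    Module.End k (Finset (Fin n) → R) := ∑ j, leftMul k R n (X i j) * creation q R j

lemma isQExterior_matrixCreation (hq : q ≠ 0) {X : Fin n → Fin n → R}
    (hX : ∀ a b, MRel q X a b → a = b) : IsQExterior q (matrixCreation q X) :=
  isQExterior_creation.matrix_mul hq
    (MRel.eq_of_map (leftMul k R n) fun _ _ h => congrArg _ (hX _ _ h))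
    fun _ _ _ => commute_leftMul_creation _ _

/-- The quantum minor with rows `I` and columns `T`. -/
noncomputable def qminor (q : k) (X : Fin n → Fin n → R) (I T : Finset (Fin n)) : R :=
  sortedProd (matrixCreation q X) I (vacuum R n) T

/-- The quantum minor whose rows are given by a word. -/
noncomputable def wordMinor (q : k) (X : Fin n → Fin n → R) (f : Fin m → Fin n)
    (T : Finset (Fin n)) : R :=
  ∑ g : Fin m → Fin n,
    if univ.image g = T then qsign q g • (List.ofFn fun a => X (f a) (g a)).prod else 0

/-- The product of transformed creation operators along `f`, applied to the vacuum, is computed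
twice: by straightening it with the exterior relations, and by expanding every factor in the
original operators. -/
lemma wordMinor_eq (hq : q ≠ 0) {X : Fin n → Fin n → R} (hX : ∀ a b, MRel q X a b → a = b)
    (f : Fin m → Fin n) (T : Finset (Fin n)) :
    wordMinor q X f T = qsign q f • qminor q X (univ.image f) T := by
  have h1 := (isQExterior_matrixCreation hq hX).prod_ofFn f
  have h2 := prod_ofFn_sum (x := fun i j => leftMul k R n (X i j)) (y := creation q R)
    (fun _ _ _ => commute_leftMul_creation _ _) f
  rw [show (fun a => ∑ j, leftMul k R n (X (f a) j) * creation q R j) =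
    fun a => matrixCreation q X (f a) from rfl, h1] at h2
  have h3 := congrFun (LinearMap.congr_fun h2 (vacuum R n)) T
  rw [LinearMap.smul_apply, Pi.smul_apply] at h3
  rw [qminor, h3, wordMinor, LinearMap.sum_apply, Finset.sum_apply]
  refine sum_congr rfl fun g _ => ?_
  rw [isQExterior_creation.prod_ofFn g, Module.End.mul_apply, LinearMap.smul_apply,
    sortedProd_creation_vacuum, ← Function.comp_def (leftMul k R n), ← List.map_ofFn,
    ← map_list_prod, leftMul_apply, Pi.smul_apply]
  split_ifs with h
  · rw [h]; simp
  · rw [Pi.single_eq_of_ne (Ne.symm h)]; simp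

/-- Sorts the column words by their first letter. No relation between the entries is used, so
matrices other than quantum matrices are allowed; `sum_qsign_sq` depends on this. -/
lemma wordMinor_cons (q : k) (X : Fin n → Fin n → R) (l : Fin n) (f : Fin m → Fin n)
    (T : Finset (Fin n)) : wordMinor q X (Fin.cons l f : Fin (m + 1) → Fin n) T =
      ∑ c ∈ T, (-q) ^ #{t ∈ T.erase c | t < c} • (X l c * wordMinor q X f (T.erase c)) := by
  rw [wordMinor, sum_fin_cons, ← Finset.sum_filter_add_sum_filter_not univ (· ∈ T),
    Finset.sum_eq_zero (s := univ.filter (· ∉ T)), add_zero, Finset.filter_univ_mem]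
  · refine sum_congr rfl fun c hc => ?_
    rw [wordMinor, Finset.mul_sum, Finset.smul_sum]
    refine sum_congr rfl fun g _ => ?_
    rw [image_fin_cons, qsign_cons]
    by_cases hg : univ.image g = T.erase c
    · rw [if_pos hg, if_pos (by rw [hg, insert_erase hc]), hg, if_neg (notMem_erase _ _),
        List.ofFn_succ, List.prod_cons]
      simp [smul_smul]
    · rw [if_neg hg, mul_zero, smul_zero]
      split_ifs with h1 h2
      · rw [zero_smul]
      · exact absurd (by rw [← h1, erase_insert h2]) hg
      · rfl
  · intro c hc
    refine Finset.sum_eq_zero fun g _ => if_neg ?_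
    rw [image_fin_cons]
    rintro rfl
    simp at hc

lemma wordMinor_snoc (q : k) (X : Fin n → Fin n → R) (l : Fin n) (f : Fin m → Fin n)
    (T : Finset (Fin n)) : wordMinor q X (Fin.snoc f l : Fin (m + 1) → Fin n) T =
      ∑ c ∈ T, (-q) ^ #{t ∈ T.erase c | c < t} • (wordMinor q X f (T.erase c) * X l c) := by
  rw [wordMinor, sum_fin_snoc, ← Finset.sum_filter_add_sum_filter_not univ (· ∈ T),
    Finset.sum_eq_zero (s := univ.filter (· ∉ T)), add_zero, Finset.filter_univ_mem]
  · refine sum_congr rfl fun c hc => ?_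
    rw [wordMinor, Finset.sum_mul, Finset.smul_sum]
    refine sum_congr rfl fun g _ => ?_
    rw [image_fin_snoc, qsign_snoc]
    by_cases hg : univ.image g = T.erase c
    · rw [if_pos hg, if_pos (by rw [hg, insert_erase hc]), hg, if_neg (notMem_erase _ _),
        List.ofFn_succ_last, List.prod_append]
      simp [smul_smul]
    · rw [if_neg hg, zero_mul, smul_zero]
      split_ifs with h1 h2
      · rw [zero_smul]
      · exact absurd (by rw [← h1, erase_insert h2]) hg
      · rfl
  · intro c hc
    refine Finset.sum_eq_zero fun g _ => if_neg ?_
    rw [image_fin_snoc]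
    rintro rfl
    simp at hc

end FockSpace

end QuantumMatrix

namespace QuantumMatrix

/-! ### Transposition, Laplace expansions, and centrality of the quantum determinant -/

section Centrality

open Finset

variable {k : Type*} [Field k] {m n : ℕ} {q : k} {R : Type*} [Ring R] [Algebra k R]

lemma transpose_rel {X : Fin n → Fin n → R} (hX : ∀ a b, MRel q X a b → a = b)
    (a b : R) (h : MRel q (fun i j => X j i) a b) : a = b := by
  cases h with
  | col i l j hil => exact hX _ _ (MRel.row j i l hil)
  | row i j m hjm => exact hX _ _ (MRel.col j m i hjm)
  | anti i l j m hil hmj => exact (hX _ _ (MRel.anti m j l i hmj hil)).symm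
  | diag i l j m hil hjm =>
    -- Transposing exchanges the two antidiagonal entries on the right-hand side, and these commute.
    rw [hX _ _ (MRel.diag j m i l hjm hil), hX _ _ (MRel.anti j m l i hjm hil)]

lemma sum_pow_card_filter_lt (t : k) (T : Finset (Fin n)) :
    ∑ c ∈ T, t ^ #{x ∈ T | x < c} = ∑ j ∈ range #T, t ^ j := by
  induction T using Finset.induction_on_max with
  | empty => simp
  | insert a T ha ih =>
    have haT : a ∉ T := fun h => lt_irrefl _ (ha a h)
    rw [sum_insert haT, card_insert_of_notMem haT, sum_range_succ, ← ih, add_comm,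
      filter_insert, if_neg (lt_irrefl a), filter_true_of_mem ha]
    congr 1
    refine sum_congr rfl fun c hc => ?_
    rw [filter_insert, if_neg (ha c hc).not_gt]

/-- Squared $q$-signs are the signs for the parameter $-q^2$, so the sum is a word minor of the
all-ones matrix and can be expanded row by row. -/
lemma sum_qsign_sq (q : k) (I : Finset (Fin n)) (hI : #I = m) :
    ∑ f : Fin m → Fin n, (if univ.image f = I then qsign q f * qsign q f else 0) =
      ∏ i ∈ range m, ∑ j ∈ range (i + 1), (q ^ 2) ^ j := by
  by_cases hn : Nonempty (Fin n) ∨ m = 0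
  -- The row word is irrelevant for a constant matrix, but some word has to exist.
  · obtain ⟨f₀⟩ : Nonempty (Fin m → Fin n) := by
      rcases hn with ⟨⟨c⟩⟩ | rfl
      · exact ⟨fun _ => c⟩
      · exact ⟨Fin.elim0⟩
    have : ∑ f : Fin m → Fin n, (if univ.image f = I then qsign q f * qsign q f else 0) =
        wordMinor (-q ^ 2) (fun _ _ => (1 : k)) f₀ I := by
      refine sum_congr rfl fun f _ => ?_
      simp [qsign_mul_self]
    rw [this]
    clear this hn
    induction m generalizing I with
    | zero =>
      obtain rfl := card_eq_zero.mp hI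
      simp [wordMinor, qsign_of_injective _ (Function.injective_of_subsingleton _), invNum]
    | succ m ih =>
      rw [← Fin.cons_self_tail f₀, wordMinor_cons, prod_range_succ,
        show range (m + 1) = range #I by rw [hI], ← sum_pow_card_filter_lt, Finset.mul_sum]
      refine sum_congr rfl fun c hc => ?_
      rw [ih (I.erase c) (by rw [card_erase_of_mem hc, hI]; rfl), neg_neg, filter_erase,
        Finset.erase_eq_of_notMem (s := {x ∈ I | x < c}) (by simp), one_mul, smul_eq_mul, mul_comm]
  · push Not at hn
    have := hn.1
    have h0 : I = ∅ := by ext x; exact (IsEmpty.false x).elim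
    subst h0
    exact absurd hI.symm hn.2

lemma qfactorial_ne_zero (hroot : ∀ m : ℕ, 0 < m → q ^ m ≠ 1) (m : ℕ) :
    ∏ i ∈ range m, ∑ j ∈ range (i + 1), (q ^ 2) ^ j ≠ 0 := by
  refine prod_ne_zero_iff.mpr fun i _ h => ?_
  have h1 := geom_sum_mul (q ^ 2) (i + 1)
  rw [h, zero_mul, ← pow_mul] at h1
  exact hroot (2 * (i + 1)) (by omega) (sub_eq_zero.mp h1.symm)

/-- Averaging over all orderings of the rows puts rows and columns on the same footing, at the price
of a $q^2$-factorial. -/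
lemma sum_qsign_smul_wordMinor (hq : q ≠ 0) {X : Fin n → Fin n → R}
    (hX : ∀ a b, MRel q X a b → a = b) (I T : Finset (Fin n)) (hI : #I = m) :
    ∑ f : Fin m → Fin n, (if univ.image f = I then qsign q f • wordMinor q X f T else 0) =
      (∏ i ∈ range m, ∑ j ∈ range (i + 1), (q ^ 2) ^ j) • qminor q X I T := by
  rw [← sum_qsign_sq q I hI, Finset.sum_smul]
  refine sum_congr rfl fun f _ => ?_
  split_ifs with h
  · rw [wordMinor_eq hq hX, h, smul_smul]
  · simp

/-- Quantum minors of the transposed matrix. -/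
lemma qminor_transpose (hq : q ≠ 0) (hroot : ∀ m : ℕ, 0 < m → q ^ m ≠ 1) {X : Fin n → Fin n → R}
    (hX : ∀ a b, MRel q X a b → a = b) {I T : Finset (Fin n)} (h : #I = #T) :
    qminor q (fun i j => X j i) T I = qminor q X I T := by
  have h1 := sum_qsign_smul_wordMinor hq hX I T rfl
  have h2 := sum_qsign_smul_wordMinor hq (transpose_rel hX) T I h.symm
  have h3 := qfactorial_ne_zero hroot #I
  -- After multiplication by the nonzero factorial, both sides are the sum over row words `f` and
  -- column words `g` of the two signs times the product of the `X (f a) (g a)`.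
  rw [← smul_right_inj h3, ← h1, ← h2]
  simp only [wordMinor, Finset.smul_sum]
  have swap : ∀ (p : (Fin #I → Fin n) → Prop) [DecidablePred p]
      (F : (Fin #I → Fin n) → (Fin #I → Fin n) → R),
      (∑ f, if p f then ∑ g, F f g else 0) = ∑ f, ∑ g, if p f then F f g else 0 := by
    intro p _ F
    refine sum_congr rfl fun f _ => ?_
    split_ifs <;> simp
  rw [swap, swap, Finset.sum_comm]
  refine sum_congr rfl fun f _ => sum_congr rfl fun g _ => ?_
  split_ifs <;> simp [smul_smul, mul_comm]

lemma image_succAbove (i : Fin (m + 1)) : univ.image i.succAbove = univ.erase i := by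
  ext t
  simp

lemma card_filter_lt_erase (i : Fin (m + 1)) : #{t ∈ univ.erase i | t < i} = (i : ℕ) := by
  rw [← Fin.card_Iio i]
  congr 1
  ext t
  simpa using fun h : t < i => h.ne

lemma card_filter_gt_erase (i : Fin (m + 1)) : #{t ∈ univ.erase i | i < t} = m - (i : ℕ) := by
  have h : {t ∈ univ.erase i | i < t} = Ioi i := by
    ext t
    simpa using fun h : i < t => h.ne'
  rw [h, Fin.card_Ioi, Nat.add_sub_cancel]

lemma insert_erase_univ (i : Fin (m + 1)) : insert i (univ.erase i) = univ :=
  insert_erase (mem_univ i)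

/-- Laplace expansion of the quantum determinant along a row. -/
lemma laplace_row (hq : q ≠ 0) {X : Fin (m + 1) → Fin (m + 1) → R}
    (hX : ∀ a b, MRel q X a b → a = b) (l i : Fin (m + 1)) :
    ∑ c : Fin (m + 1), (-q) ^ (c : ℕ) • (X l c * qminor q X (univ.erase i) (univ.erase c)) =
      if l = i then (-q) ^ (i : ℕ) • qminor q X univ univ else 0 := by
  -- The row word is `l` followed by all rows except `i`. For `l ≠ i` a row repeats and the $q$-sign
  -- is zero.
  have h := wordMinor_cons q X l i.succAbove univ
  rw [wordMinor_eq hq hX, qsign_cons, image_fin_cons, image_succAbove,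
    qsign_of_strictMono q (Fin.strictMono_succAbove i), mul_one] at h
  simp only [card_filter_lt_erase, wordMinor_eq hq hX, image_succAbove,
    qsign_of_strictMono q (Fin.strictMono_succAbove i), one_smul] at h
  rw [← h]
  by_cases hl : l = i
  · subst hl
    rw [if_pos rfl, if_neg (notMem_erase _ _), card_filter_lt_erase, insert_erase_univ]
  · rw [if_neg hl, if_pos (by simp [hl]), zero_smul]

/-- Laplace expansion with the minors on the left. -/
lemma laplace_row_right (hq : q ≠ 0) {X : Fin (m + 1) → Fin (m + 1) → R}
    (hX : ∀ a b, MRel q X a b → a = b) (l i : Fin (m + 1)) :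
    ∑ c : Fin (m + 1), (-q) ^ (m - (c : ℕ)) •
        (qminor q X (univ.erase i) (univ.erase c) * X l c) =
      if l = i then (-q) ^ (m - (i : ℕ)) • qminor q X univ univ else 0 := by
  have h := wordMinor_snoc q X l i.succAbove univ
  rw [wordMinor_eq hq hX, qsign_snoc, image_fin_snoc, image_succAbove,
    qsign_of_strictMono q (Fin.strictMono_succAbove i), mul_one] at h
  simp only [card_filter_gt_erase, wordMinor_eq hq hX, image_succAbove,
    qsign_of_strictMono q (Fin.strictMono_succAbove i), one_smul] at h
  rw [← h]
  by_cases hl : l = i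
  · subst hl
    rw [if_pos rfl, if_neg (notMem_erase _ _), card_filter_gt_erase, insert_erase_univ]
  · rw [if_neg hl, if_pos (by simp [hl]), zero_smul]

lemma qdet_eq_qminor (hq : q ≠ 0) {X : Fin n → Fin n → R} (hX : ∀ a b, MRel q X a b → a = b) :
    qdet q X = qminor q X univ univ := by
  have h := wordMinor_eq hq hX id univ
  rw [qsign_of_strictMono q strictMono_id, one_smul, image_id] at h
  rw [← h, wordMinor, ← Finset.sum_filter, qdet]
  refine Finset.sum_bij (fun σ _ => σ) ?_ (fun _ _ _ _ h => DFunLike.coe_injective h) ?_ ?_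
  · intro σ _
    simp [Finset.image_univ_equiv]
  · intro f hf
    have hs : Function.Surjective f := fun y => by
      have : y ∈ univ.image f := by rw [(mem_filter.mp hf).2]; exact mem_univ _
      simpa using this
    exact ⟨Equiv.ofBijective f (Finite.injective_iff_bijective.mp
      (Finite.injective_iff_surjective.mpr hs)), mem_univ _, rfl⟩
  · intro σ _
    rw [qsign_of_injective q σ.injective, permLength_eq_invNum]
    rfl

/-- The quantum determinant is central. -/
theorem qdet_commute (hq : q ≠ 0) (hroot : ∀ m : ℕ, 0 < m → q ^ m ≠ 1) {X : Fin n → Fin n → R}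
    (hX : ∀ a b, MRel q X a b → a = b) (a b : Fin n) : Commute (qdet q X) (X a b) := by
  obtain _ | m := n
  · exact a.elim0
  rw [qdet_eq_qminor hq hX]
  set D := qminor q X univ univ with hD
  have hq' : -q ≠ 0 := neg_ne_zero.mpr hq
  have hrow := laplace_row hq hX
  -- Column expansion with minors on the left: the row expansion of the transposed matrix, divided
  -- by $(-q)^m$.
  have hcol : ∀ c : Fin (m + 1), ∑ i : Fin (m + 1), ((-q) ^ (i : ℕ))⁻¹ •
      (qminor q X (univ.erase i) (univ.erase c) * X i b) =
      if b = c then ((-q) ^ (c : ℕ))⁻¹ • D else 0 := by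
    intro c
    have h := laplace_row_right hq (transpose_rel hX) b c
    rw [qminor_transpose hq hroot hX rfl] at h
    have h' := congrArg (fun z => ((-q) ^ m)⁻¹ • z) h
    have hp : ∀ i : Fin (m + 1), ((-q) ^ m)⁻¹ * (-q) ^ (m - (i : ℕ)) = ((-q) ^ (i : ℕ))⁻¹ := by
      intro i
      rw [pow_sub₀ _ hq' (by omega), inv_mul_cancel_left₀ (pow_ne_zero _ hq')]
    simp only [Finset.smul_sum, smul_ite, smul_zero, smul_smul, hp] at h'
    rw [← h']
    refine sum_congr rfl fun i _ => ?_
    rw [qminor_transpose hq hroot hX (by simp)]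
  -- With $A_{ic}$ the complementary minors, $\sum_{i,c}(-q)^{c-i}X_{ac}A_{ic}X_{ib}$ is summed over
  -- $i$ first here, and over $c$ first in `e2`.
  have e1 : ∑ c : Fin (m + 1), (-q) ^ (c : ℕ) • (X a c * ∑ i : Fin (m + 1), ((-q) ^ (i : ℕ))⁻¹ •
      (qminor q X (univ.erase i) (univ.erase c) * X i b)) = X a b * D := by
    simp only [hcol, mul_ite, mul_zero, smul_ite, smul_zero, sum_ite_eq, mem_univ, if_true,
      mul_smul_comm, smul_smul, mul_inv_cancel₀ (pow_ne_zero _ hq'), one_smul]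
  have e2 : ∑ c : Fin (m + 1), (-q) ^ (c : ℕ) • (X a c * ∑ i : Fin (m + 1), ((-q) ^ (i : ℕ))⁻¹ •
      (qminor q X (univ.erase i) (univ.erase c) * X i b)) = D * X a b := by
    simp only [Finset.mul_sum, Finset.smul_sum]
    rw [Finset.sum_comm]
    have : ∀ i : Fin (m + 1), ∑ c : Fin (m + 1), (-q) ^ (c : ℕ) • (X a c * ((-q) ^ (i : ℕ))⁻¹ •
        (qminor q X (univ.erase i) (univ.erase c) * X i b)) = ((-q) ^ (i : ℕ))⁻¹ •
        ((if a = i then (-q) ^ (i : ℕ) • D else 0) * X i b) := by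
      intro i
      rw [← hrow a i, Finset.sum_mul, Finset.smul_sum]
      refine sum_congr rfl fun c _ => ?_
      rw [mul_smul_comm, smul_mul_assoc, smul_comm, mul_assoc]
    simp only [this, ite_mul, zero_mul, smul_ite, smul_zero, sum_ite_eq, mem_univ, if_true,
      smul_mul_assoc, smul_smul, inv_mul_cancel₀ (pow_ne_zero _ hq'), one_smul]
  exact e2.symm.trans e1

end Centrality

end QuantumMatrix

namespace QuantumMatrix

/-! ### Abstract correspondence of stable ideals -/

section Correspondence

variable {k : Type*} [Field k] {A B : Type*} [Ring A] [Algebra k A] [Ring B] [Algebra k B]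
  {G G' : Type*} [Group G] [Group G']

/-- An elementwise form of primeness. -/
lemma IsPrimeIdeal.mem_or_mem {Q : TwoSidedIdeal B} (hQ : IsPrimeIdeal Q) {a b : B}
    (h : ∀ c, a * c * b ∈ Q) : a ∈ Q ∨ b ∈ Q := by
  -- Annihilators modulo `Q` replace the ideals generated by `a` and `b`: `J` contains `b`, `I`
  -- contains `a`, and $IJ\subseteq Q$.
  let J : TwoSidedIdeal B := .mk' {y | ∀ c, a * c * y ∈ Q}
    (fun c => by rw [mul_zero]; exact Q.zero_mem)
    (fun hx hy c => by rw [mul_add]; exact Q.add_mem (hx c) (hy c))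
    (fun hx c => by rw [mul_neg]; exact Q.neg_mem (hx c))
    (fun {r x} hx c => by rw [← mul_assoc, mul_assoc a]; exact hx _)
    (fun {x r} hx c => by rw [← mul_assoc]; exact Q.mul_mem_right _ _ (hx c))
  have hJ : ∀ y, y ∈ J ↔ ∀ c, a * c * y ∈ Q := fun y => TwoSidedIdeal.mem_mk' _ _ _ _ _ _ _
  let I : TwoSidedIdeal B := .mk' {x | ∀ y ∈ J, ∀ c, x * c * y ∈ Q}
    (fun y _ c => by rw [zero_mul, zero_mul]; exact Q.zero_mem)
    (fun hx hx' y hy c => by rw [add_mul, add_mul]; exact Q.add_mem (hx y hy c) (hx' y hy c))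
    (fun hx y hy c => by rw [neg_mul, neg_mul]; exact Q.neg_mem (hx y hy c))
    (fun {r x} hx y hy c => by
      rw [mul_assoc, mul_assoc, ← mul_assoc x]; exact Q.mul_mem_left _ _ (hx y hy c))
    (fun {x r} hx y hy c => by rw [mul_assoc x]; exact hx y hy _)
  have hI : ∀ x, x ∈ I ↔ ∀ y ∈ J, ∀ c, x * c * y ∈ Q := fun x => TwoSidedIdeal.mem_mk' _ _ _ _ _ _ _
  rcases hQ.le_or_le I J (fun x hx y hy => by simpa using (hI x).mp hx y hy 1) with h' | h'
  · exact Or.inl (h' ((hI a).mpr fun y hy => (hJ y).mp hy))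
  · exact Or.inr (h' ((hJ b).mpr h))

lemma ne_top_iff {Q : TwoSidedIdeal B} : Q ≠ ⊤ ↔ (1 : B) ∉ Q := by
  rw [Ne, ← TwoSidedIdeal.one_mem_iff]

/-- A pair of maps between ideals of `A` and of `B` which identifies the stable ideals of `A`
with those of `B`, compatibly with products and primes. -/
structure StableCorrespondence (ρ : G →* (A ≃ₐ[k] A)) (ρ' : G' →* (B ≃ₐ[k] B)) (s : B →ₐ[k] A)
    (im : TwoSidedIdeal A → TwoSidedIdeal B) (ext : TwoSidedIdeal B → TwoSidedIdeal A) :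
    Prop where
  mem_im : ∀ P, IsStable ρ P → ∀ b, b ∈ im P ↔ s b ∈ P
  mem_ext : ∀ Q b, s b ∈ ext Q ↔ b ∈ Q
  ext_le : ∀ P, IsStable ρ P → ∀ Q, Q ≤ im P → ext Q ≤ P
  le_ext : ∀ P, IsStable ρ P → ∀ Q, im P ≤ Q → P ≤ ext Q
  stable_im : ∀ P, IsStable ρ P → IsStable ρ' (im P)
  stable_ext : ∀ Q, IsStable ρ' Q → IsStable ρ (ext Q)
  mul_mem : ∀ P, IsStable ρ P → ∀ I J, (∀ a ∈ I, ∀ b ∈ J, a * b ∈ im P) →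
    ∀ a ∈ ext I, ∀ b ∈ ext J, a * b ∈ P
  prime_ext : ∀ Q, IsPrimeIdeal Q → IsPrimeIdeal (ext Q)

namespace StableCorrespondence

variable {ρ : G →* (A ≃ₐ[k] A)} {ρ' : G' →* (B ≃ₐ[k] B)} {s : B →ₐ[k] A}
  {im : TwoSidedIdeal A → TwoSidedIdeal B} {ext : TwoSidedIdeal B → TwoSidedIdeal A}
  (c : StableCorrespondence ρ ρ' s im ext)

include c

lemma ext_im {P : TwoSidedIdeal A} (hP : IsStable ρ P) : ext (im P) = P :=
  le_antisymm (c.ext_le P hP _ le_rfl) (c.le_ext P hP _ le_rfl)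

lemma im_ext {Q : TwoSidedIdeal B} (hQ : IsStable ρ' Q) : im (ext Q) = Q :=
  TwoSidedIdeal.ext fun b => by rw [c.mem_im _ (c.stable_ext Q hQ), c.mem_ext]

lemma le_im {P : TwoSidedIdeal A} (hP : IsStable ρ P) {Q : TwoSidedIdeal B} (h : ext Q ≤ P) :
    Q ≤ im P :=
  fun b hb => (c.mem_im P hP b).mpr (h ((c.mem_ext Q b).mpr hb))

lemma im_ne_top {P : TwoSidedIdeal A} (hP : IsStable ρ P) : im P ≠ ⊤ ↔ P ≠ ⊤ := by
  rw [ne_top_iff, ne_top_iff, c.mem_im P hP, map_one]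

lemma isGPrime_im {P : TwoSidedIdeal A} (hP : IsGPrime ρ P) : IsGPrime ρ' (im P) where
  ne_top := (c.im_ne_top hP.stable).mpr hP.ne_top
  stable := c.stable_im P hP.stable
  le_or_le I J hI hJ hIJ :=
    (hP.le_or_le _ _ (c.stable_ext I hI) (c.stable_ext J hJ) (c.mul_mem P hP.stable I J hIJ)).imp
      (c.le_im hP.stable) (c.le_im hP.stable)

lemma isPrimeIdeal_im {P : TwoSidedIdeal A} (hP : IsPrimeIdeal P) (hS : IsStable ρ P) :
    IsPrimeIdeal (im P) where
  ne_top := (c.im_ne_top hS).mpr hP.ne_top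
  le_or_le I J hIJ := (hP.le_or_le _ _ (c.mul_mem P hS I J hIJ)).imp (c.le_im hS) (c.le_im hS)

lemma isGPrime_ext {Q : TwoSidedIdeal B} (hQ : IsGPrime ρ' Q) : IsGPrime ρ (ext Q) where
  ne_top := by
    rw [← c.im_ne_top (c.stable_ext Q hQ.stable), c.im_ext hQ.stable]
    exact hQ.ne_top
  stable := c.stable_ext Q hQ.stable
  le_or_le I J hI hJ hIJ := by
    refine (hQ.le_or_le _ _ (c.stable_im I hI) (c.stable_im J hJ) fun a ha b hb => ?_).imp
      (c.le_ext I hI Q) (c.le_ext J hJ Q)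
    rw [c.mem_im I hI] at ha
    rw [c.mem_im J hJ] at hb
    rw [← c.mem_ext, map_mul]
    exact hIJ _ ha _ hb

lemma bijOn_isGPrime : Set.BijOn im {P | IsGPrime ρ P} {Q | IsGPrime ρ' Q} := by
  refine ⟨fun P hP => c.isGPrime_im hP, fun P hP P' hP' h => ?_, fun Q hQ => ?_⟩
  · rw [← c.ext_im hP.stable, ← c.ext_im hP'.stable, h]
  · exact ⟨ext Q, c.isGPrime_ext hQ, c.im_ext hQ.stable⟩

lemma bijOn_isPrimeIdeal : Set.BijOn im {P | IsPrimeIdeal P ∧ IsStable ρ P}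
    {Q | IsPrimeIdeal Q ∧ IsStable ρ' Q} := by
  refine ⟨fun P hP => ⟨c.isPrimeIdeal_im hP.1 hP.2, c.stable_im P hP.2⟩,
    fun P hP P' hP' h => ?_, fun Q hQ => ?_⟩
  · rw [← c.ext_im hP.2, ← c.ext_im hP'.2, h]
  -- Primeness of `ext Q` tests ideals that need not be stable, so it cannot be transported as in
  -- `isGPrime_ext` and is part of the data.
  · exact ⟨ext Q, ⟨c.prime_ext Q hQ.1, c.stable_ext Q hQ.2⟩, c.im_ext hQ.2⟩

end StableCorrespondence

/-- The correspondence given by an isomorphism, when both actions are trivial. -/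
lemma StableCorrespondence.of_trivial {ρ : G →* (A ≃ₐ[k] A)} {ρ' : G' →* (B ≃ₐ[k] B)}
    (s : B →ₐ[k] A) (π : A →ₐ[k] B) (hπs : ∀ b, π (s b) = b) (hsπ : ∀ a, s (π a) = a)
    (im : TwoSidedIdeal A → TwoSidedIdeal B)
    (him : ∀ P b, b ∈ im P ↔ ∃ a ∈ P, π a = b) (hρ : ∀ g a, ρ g a = a)
    (hρ' : ∀ g b, ρ' g b = b) :
    StableCorrespondence ρ ρ' s im (TwoSidedIdeal.comap π) := by
  have mem_im : ∀ P b, b ∈ im P ↔ s b ∈ P := fun P b => by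
    rw [him]
    exact ⟨by rintro ⟨a, ha, rfl⟩; rwa [hsπ], fun h => ⟨_, h, hπs b⟩⟩
  have mem_comap : ∀ (Q : TwoSidedIdeal B) a, a ∈ TwoSidedIdeal.comap π Q ↔ π a ∈ Q :=
    fun Q a => TwoSidedIdeal.mem_comap _
  exact
    { mem_im := fun P _ => mem_im P
      mem_ext := fun Q b => by rw [mem_comap, hπs]
      ext_le := fun P _ Q h a ha => by
        have := (mem_im P _).mp (h ((mem_comap Q a).mp ha))
        rwa [hsπ] at this
      le_ext := fun P _ Q h a ha => (mem_comap Q a).mpr (h ((him P _).mpr ⟨a, ha, rfl⟩))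
      stable_im := fun P _ g b hb => by rwa [hρ']
      stable_ext := fun P _ g b hb => by rwa [hρ]
      mul_mem := fun P _ I J h a ha b hb => by
        have := (mem_im P _).mp (h _ ((mem_comap I a).mp ha) _ ((mem_comap J b).mp hb))
        rwa [← map_mul, hsπ] at this
      prime_ext := fun Q hQ =>
        { ne_top := by
            rw [ne_top_iff, mem_comap, map_one, ← ne_top_iff]
            exact hQ.ne_top
          le_or_le := fun I J h => by
            have key : ∀ K : TwoSidedIdeal A, im K ≤ Q → K ≤ TwoSidedIdeal.comap π Q :=
              fun K h a ha => (mem_comap Q a).mpr (h ((him K _).mpr ⟨a, ha, rfl⟩))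
            refine (hQ.le_or_le (im I) (im J) fun a ha b hb => ?_).imp (key I) (key J)
            have := (mem_comap Q _).mp (h _ ((mem_im I a).mp ha) _ ((mem_im J b).mp hb))
            rwa [← map_mul, hπs] at this } }

end Correspondence

/-! ### Coefficients and extended ideals in a Laurent polynomial ring -/

section Laurent

open LaurentPolynomial

variable {k : Type*} [Field k] {A B : Type*} [Ring A] [Algebra k A] [Ring B] [Algebra k B]
  {G G' : Type*} [Group G] [Group G']

/-- A presentation of `A` as a Laurent polynomial ring over `B` in a central unit `u`. -/
structure LaurentSplitting (k A B : Type*) [Field k] [Ring A] [Algebra k A] [Ring B]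
    [Algebra k B] where
  /-- The coefficient embedding. -/
  s : B →ₐ[k] A
  /-- The variable. -/
  u : Aˣ
  /-- The comparison with Laurent polynomials. -/
  toLaurent : A →ₐ[k] B[T;T⁻¹]
  toLaurent_s : ∀ b, toLaurent (s b) = C b
  toLaurent_u : toLaurent u = T 1
  injective : Function.Injective toLaurent

namespace LaurentSplitting

variable (L : LaurentSplitting k A B)

/-- The coefficient of `u ^ m`. -/
noncomputable def coeff (m : ℤ) (a : A) : B := (L.toLaurent a).coeff m

lemma toLaurent_zpow (m : ℤ) : L.toLaurent ((L.u ^ m : Aˣ) : A) = T m := by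
  have hinv : L.toLaurent ((L.u⁻¹ : Aˣ) : A) = T (-1) := by
    refine left_inv_eq_right_inv (a := L.toLaurent L.u) ?_ ?_
    · rw [← map_mul, Units.inv_mul, map_one]
    · rw [L.toLaurent_u, ← T_add]; simp
  cases m with
  | ofNat m =>
    rw [Int.ofNat_eq_natCast, zpow_natCast, Units.val_pow_eq_pow_val, map_pow, L.toLaurent_u, T_pow,
      mul_one]
  | negSucc m =>
    rw [zpow_negSucc, ← inv_pow, Units.val_pow_eq_pow_val, map_pow, hinv, T_pow]
    congr 1
    rw [Int.negSucc_eq]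
    push_cast
    ring

lemma toLaurent_monomial (b : B) (m : ℤ) :
    L.toLaurent (L.s b * ((L.u ^ m : Aˣ) : A)) = .single m b := by
  rw [map_mul, L.toLaurent_s, L.toLaurent_zpow, ← single_eq_C_mul_T]

lemma coeff_monomial (b : B) (m i : ℤ) :
    L.coeff i (L.s b * ((L.u ^ m : Aˣ) : A)) = if m = i then b else 0 := by
  rw [coeff, toLaurent_monomial]
  exact Finsupp.single_apply

lemma coeff_add (i : ℤ) (a b : A) : L.coeff i (a + b) = L.coeff i a + L.coeff i b := by
  simp [coeff]

lemma coeff_sub (i : ℤ) (a b : A) : L.coeff i (a - b) = L.coeff i a - L.coeff i b := by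
  simp [coeff]

lemma coeff_smul (i : ℤ) (r : k) (a : A) : L.coeff i (r • a) = r • L.coeff i a := by
  simp [coeff]

lemma coeff_sum {ι : Type*} (S : Finset ι) (f : ι → A) (i : ℤ) :
    L.coeff i (∑ j ∈ S, f j) = ∑ j ∈ S, L.coeff i (f j) := by
  classical
  induction S using Finset.induction_on with
  | empty => simp [coeff]
  | insert a S ha ih => rw [Finset.sum_insert ha, Finset.sum_insert ha, coeff_add, ih]

lemma coeff_s (b : B) (i : ℤ) : L.coeff i (L.s b) = if i = 0 then b else 0 := by
  rw [coeff, L.toLaurent_s, C_apply]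

lemma ext_coeff {a b : A} (h : ∀ m, L.coeff m a = L.coeff m b) : a = b :=
  L.injective (LaurentPolynomial.ext h)

lemma expand_of_support {a : A} {S : Finset ℤ} (hS : ∀ m, m ∉ S → L.coeff m a = 0) :
    a = ∑ m ∈ S, L.s (L.coeff m a) * ((L.u ^ m : Aˣ) : A) := by
  refine L.ext_coeff fun i => ?_
  rw [coeff_sum]
  simp only [coeff_monomial, Finset.sum_ite_eq']
  split_ifs with h
  · rfl
  · exact hS i h

lemma exists_support (a : A) : ∃ S : Finset ℤ, ∀ m, m ∉ S → L.coeff m a = 0 :=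
  ⟨(L.toLaurent a).coeff.support, fun _ h => Finsupp.notMem_support_iff.mp h⟩

lemma commute_u (a : A) (m : ℤ) : Commute ((L.u ^ m : Aˣ) : A) a := by
  refine L.injective ?_
  rw [map_mul, map_mul, L.toLaurent_zpow]
  exact commute_T m _

lemma monomial_mem_iff (P : TwoSidedIdeal A) (a : A) (m : ℤ) :
    a * ((L.u ^ m : Aˣ) : A) ∈ P ↔ a ∈ P := by
  refine ⟨fun h => ?_, fun h => P.mul_mem_right _ _ h⟩
  have := P.mul_mem_right _ ((L.u ^ m)⁻¹ : Aˣ) h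
  rwa [mul_assoc, Units.mul_inv, mul_one] at this

lemma mem_of_coeff_mem {P : TwoSidedIdeal A} {a : A} (h : ∀ m, L.s (L.coeff m a) ∈ P) :
    a ∈ P := by
  obtain ⟨S, hS⟩ := L.exists_support a
  rw [L.expand_of_support hS]
  exact P.finsetSum_mem _ _ fun m _ => P.mul_mem_right _ _ (h m)

/-- The ideal of `A` generated by an ideal of `B`. -/
noncomputable def extend (Q : TwoSidedIdeal B) : TwoSidedIdeal A :=
  -- As the kernel of coefficientwise reduction modulo `Q`, this is a two-sided ideal without
  -- further checks.
  TwoSidedIdeal.ker ((AddMonoidAlgebra.mapRingHom ℤ Q.ringCon.mk').comp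
    (L.toLaurent : A →+* B[T;T⁻¹]))

lemma mk'_eq_zero (Q : TwoSidedIdeal B) (b : B) : Q.ringCon.mk' b = 0 ↔ b ∈ Q := by
  rw [← TwoSidedIdeal.mem_ker, TwoSidedIdeal.ker_ringCon_mk']

lemma mem_extend (Q : TwoSidedIdeal B) (a : A) : a ∈ L.extend Q ↔ ∀ m, L.coeff m a ∈ Q := by
  rw [extend, TwoSidedIdeal.mem_ker, ← AddMonoidAlgebra.coeff_inj, DFunLike.ext_iff]
  refine forall_congr' fun m => ?_
  rw [← mk'_eq_zero]
  simp [coeff]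

lemma s_mem_extend (Q : TwoSidedIdeal B) (b : B) : L.s b ∈ L.extend Q ↔ b ∈ Q := by
  rw [mem_extend]
  refine ⟨fun h => by simpa [coeff_s] using h 0, fun h m => ?_⟩
  rw [coeff_s]
  split_ifs
  · exact h
  · exact Q.zero_mem

end LaurentSplitting

end Laurent

end QuantumMatrix

namespace QuantumMatrix

/-! ### Homogeneity of stable ideals, and extension of primes -/

section LaurentStable

open LaurentPolynomial

variable {k : Type*} [Field k] {A B : Type*} [Ring A] [Algebra k A] [Ring B] [Algebra k B]
  {G G' : Type*} [Group G] [Group G']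

lemma smul_mem_ideal {P : TwoSidedIdeal A} (r : k) {a : A} (ha : a ∈ P) : r • a ∈ P := by
  rw [Algebra.smul_def]
  exact P.mul_mem_left _ _ ha

namespace LaurentSplitting

variable (L : LaurentSplitting k A B)

lemma map_zpow_u (f : A ≃ₐ[k] A) (t : kˣ) (hu : f L.u = (t : k) • (L.u : A)) (m : ℤ) :
    f ((L.u ^ m : Aˣ) : A) = ((t ^ m : kˣ) : k) • ((L.u ^ m : Aˣ) : A) := by
  have h1 : Units.map (f : A →* A) L.u = Units.map (algebraMap k A : k →* A) t * L.u := by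
    ext
    simpa [Algebra.smul_def] using hu
  have hc : Commute (Units.map (algebraMap k A : k →* A) t) L.u := by
    ext
    simpa using Algebra.commutes (t : k) (L.u : A)
  have h2 := congrArg (fun v : Aˣ => ((v ^ m : Aˣ) : A)) h1
  rw [hc.mul_zpow, ← map_zpow, ← map_zpow, Units.val_mul] at h2
  rw [Algebra.smul_def]
  exact h2

lemma coeff_map (f : A ≃ₐ[k] A) (τ : B ≃ₐ[k] B) (t : kˣ) (hs : ∀ b, f (L.s b) = L.s (τ b))
    (hu : f L.u = (t : k) • (L.u : A)) (m : ℤ) (a : A) :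
    L.coeff m (f a) = ((t ^ m : kˣ) : k) • τ (L.coeff m a) := by
  obtain ⟨S, hS⟩ := L.exists_support a
  conv_lhs => rw [L.expand_of_support hS]
  simp only [map_sum, map_mul, hs, L.map_zpow_u f t hu, mul_smul_comm, coeff_sum, coeff_smul,
    coeff_monomial]
  simp only [smul_ite, smul_zero, Finset.sum_ite_eq']
  split_ifs with h
  · rfl
  · rw [hS m h, map_zero, smul_zero]

/-- Ideals stable under a rescaling of infinite order of the variable are homogeneous. -/
lemma s_coeff_mem {P : TwoSidedIdeal A} (f : A ≃ₐ[k] A) (hP : ∀ a ∈ P, f a ∈ P) (t : kˣ)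
    (ht : Function.Injective fun m : ℤ => t ^ m) (hs : ∀ b, f (L.s b) = L.s b)
    (hu : f L.u = (t : k) • (L.u : A)) {a : A} (ha : a ∈ P) (m : ℤ) :
    L.s (L.coeff m a) ∈ P := by
  obtain ⟨S, hS⟩ := L.exists_support a
  induction S using Finset.induction_on generalizing a m with
  | empty =>
    rw [hS m (by simp), map_zero]
    exact P.zero_mem
  | insert j S hj ih =>
    -- Subtracting $t^ja$ removes degree $j$ and multiplies each other coefficient by $t^i-t^j\neq
    -- 0$, so the support shrinks and the induction hypothesis applies.
    have hcoeff : ∀ i, L.coeff i (f a - ((t ^ j : kˣ) : k) • a) =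
        (((t ^ i : kˣ) : k) - ((t ^ j : kˣ) : k)) • L.coeff i a := by
      intro i
      rw [coeff_sub, coeff_smul, L.coeff_map f AlgEquiv.refl t hs hu, sub_smul]
      rfl
    have key : ∀ i, i ≠ j → L.s (L.coeff i a) ∈ P := by
      intro i hi
      have h := ih (P.sub_mem (hP a ha) (smul_mem_ideal ((t ^ j : kˣ) : k) ha)) i fun i hi => by
        rw [hcoeff]
        rcases eq_or_ne i j with rfl | hij
        · rw [sub_self, zero_smul]
        · rw [hS i (by simp [hi, hij]), smul_zero]
      rw [hcoeff, map_smul] at h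
      have h0 : ((t ^ i : kˣ) : k) - ((t ^ j : kˣ) : k) ≠ 0 :=
        sub_ne_zero.mpr fun h => hi (ht (Units.ext h))
      have := smul_mem_ideal (((t ^ i : kˣ) : k) - ((t ^ j : kˣ) : k))⁻¹ h
      rwa [smul_smul, inv_mul_cancel₀ h0, one_smul] at this
    by_cases hm : m = j
    · subst hm
      -- The remaining monomial is `a` minus all the others.
      rw [← L.monomial_mem_iff P _ m]
      have h := L.expand_of_support hS
      rw [Finset.sum_insert hj, ← sub_eq_iff_eq_add] at h
      rw [← h]
      refine P.sub_mem ha (P.finsetSum_mem _ _ fun i hi => P.mul_mem_right _ _ (key i ?_))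
      rintro rfl
      exact hj hi
    · exact key m hm

lemma extend_mul_mem {P : TwoSidedIdeal A} {I J : TwoSidedIdeal B}
    (h : ∀ a ∈ I, ∀ b ∈ J, L.s (a * b) ∈ P) {a b : A} (ha : a ∈ L.extend I)
    (hb : b ∈ L.extend J) : a * b ∈ P := by
  obtain ⟨S, hS⟩ := L.exists_support a
  obtain ⟨S', hS'⟩ := L.exists_support b
  rw [mem_extend] at ha hb
  rw [L.expand_of_support hS, L.expand_of_support hS', Finset.sum_mul_sum]
  refine P.finsetSum_mem _ _ fun i _ => P.finsetSum_mem _ _ fun j _ => ?_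
  rw [mul_assoc, ← mul_assoc _ (L.s _), (L.commute_u (L.s (L.coeff j b)) i).eq, mul_assoc,
    ← mul_assoc, ← map_mul]
  exact P.mul_mem_right _ _ (h _ (ha i) _ (hb j))

/-- For `a`, `b` outside the extension with top degrees $i$, $j$ modulo `Q`, the coefficient of
$a\,s(c)\,b$ in degree $i+j$ is $a_i c\,b_j$ modulo `Q`. If the product of the ideals lies in the
extension, this is in `Q` for every $c$, against primeness of `Q`. -/
lemma isPrimeIdeal_extend {Q : TwoSidedIdeal B} (hQ : IsPrimeIdeal Q) :
    IsPrimeIdeal (L.extend Q) where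
  ne_top := by
    rw [ne_top_iff, ← map_one L.s, s_mem_extend, ← ne_top_iff]
    exact hQ.ne_top
  le_or_le I J hIJ := by
    by_contra! hcon
    obtain ⟨a, haI, ha⟩ := SetLike.not_le_iff_exists.mp hcon.1
    obtain ⟨b, hbJ, hb⟩ := SetLike.not_le_iff_exists.mp hcon.2
    let Ψ : A →+* Q.ringCon.Quotient[T;T⁻¹] :=
      (AddMonoidAlgebra.mapRingHom ℤ Q.ringCon.mk').comp (L.toLaurent : A →+* B[T;T⁻¹])
    have hΨ : ∀ x, x ∈ L.extend Q ↔ Ψ x = 0 := fun x => TwoSidedIdeal.mem_ker _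
    have hΨc : ∀ x m, (Ψ x).coeff m = Q.ringCon.mk' (L.coeff m x) := fun x m => by
      simp [Ψ, coeff]
    have hne : ∀ x, x ∉ L.extend Q → (Ψ x).coeff.support.Nonempty := fun x hx => by
      rw [Finsupp.support_nonempty_iff]
      exact fun h => hx ((hΨ x).mpr (AddMonoidAlgebra.coeff_eq_zero.mp h))
    obtain ⟨i, hi, himax⟩ := (Ψ a).coeff.support.exists_max_image id (hne a ha)
    obtain ⟨j, hj, hjmax⟩ := (Ψ b).coeff.support.exists_max_image id (hne b hb)
    have hmem : ∀ c, L.coeff i a * c * L.coeff j b ∈ Q := by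
      intro c
      have h0 : Ψ (a * L.s c * b) = 0 :=
        (hΨ _).mp (hIJ _ (I.mul_mem_right _ _ haI) _ hbJ)
      have hac : ∀ m, (Ψ (a * L.s c)).coeff m = (Ψ a).coeff m * Q.ringCon.mk' c := by
        intro m
        rw [hΨc, hΨc, ← map_mul, coeff, map_mul, L.toLaurent_s, ← single_eq_C,
          AddMonoidAlgebra.coeff_mul_single_zero]
        rfl
      rw [map_mul] at h0
      have h1 := AddMonoidAlgebra.coeff_mul_add_of_uniqueAdd (f := Ψ (a * L.s c)) (g := Ψ b)
        (a0 := i) (b0 := j) (by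
          intro x y hx hy hxy
          have hx' : x ∈ (Ψ a).coeff.support := by
            rw [Finsupp.mem_support_iff, hac] at hx
            exact Finsupp.mem_support_iff.mpr (left_ne_zero_of_mul hx)
          have h1 := himax x hx'
          have h2 := hjmax y hy
          simp only [id] at h1 h2
          omega)
      rw [h0, hac, hΨc, hΨc, ← map_mul, ← map_mul] at h1
      exact (mk'_eq_zero Q _).mp h1.symm
    rw [Finsupp.mem_support_iff, hΨc, Ne, mk'_eq_zero] at hi hj
    exact (hQ.mem_or_mem hmem).elim hi hj

/-- The correspondence between stable ideals of a Laurent polynomial ring and of its ring of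
coefficients. -/
lemma stableCorrespondence {ρ : G →* (A ≃ₐ[k] A)} {ρ' : G' →* (B ≃ₐ[k] B)}
    (π : A →ₐ[k] B) (hπs : ∀ b, π (L.s b) = b) (hπu : π L.u = 1)
    (im : TwoSidedIdeal A → TwoSidedIdeal B) (him : ∀ P b, b ∈ im P ↔ ∃ a ∈ P, π a = b)
    (h₁ : ∀ g, ∃ (g' : G') (t : kˣ), (∀ b, ρ g (L.s b) = L.s (ρ' g' b)) ∧
      ρ g L.u = (t : k) • (L.u : A))
    (h₂ : ∀ g', ∃ g : G, ∀ b, ρ g (L.s b) = L.s (ρ' g' b))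
    (h₃ : ∃ (g : G) (t : kˣ), Function.Injective (fun m : ℤ => t ^ m) ∧
      (∀ b, ρ g (L.s b) = L.s b) ∧ ρ g L.u = (t : k) • (L.u : A)) :
    StableCorrespondence ρ ρ' L.s im L.extend := by
  obtain ⟨g₀, t, ht, hgs, hgu⟩ := h₃
  have hcoeff : ∀ P, IsStable ρ P → ∀ a ∈ P, ∀ m, L.s (L.coeff m a) ∈ P :=
    fun P hP a ha => L.s_coeff_mem (ρ g₀) (hP g₀) t ht hgs hgu ha
  have hπz : ∀ m : ℤ, π ((L.u ^ m : Aˣ) : A) = 1 := by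
    intro m
    have h : Units.map (π : A →* B) L.u = 1 := Units.ext hπu
    have h' : Units.map (π : A →* B) (L.u ^ m) = 1 := by rw [map_zpow, h, one_zpow]
    exact congrArg Units.val h'
  -- Setting $u=1$ adds up the coefficients, and by homogeneity each of them already lies in `P`.
  have mem_im : ∀ P, IsStable ρ P → ∀ b, b ∈ im P ↔ L.s b ∈ P := by
    intro P hP b
    rw [him]
    refine ⟨?_, fun h => ⟨_, h, hπs b⟩⟩
    rintro ⟨a, ha, rfl⟩
    obtain ⟨S, hS⟩ := L.exists_support a
    rw [L.expand_of_support hS]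
    simp only [map_sum, map_mul, hπs, hπz, mul_one]
    exact P.finsetSum_mem _ _ fun m _ => hcoeff P hP a ha m
  exact
    { mem_im := mem_im
      mem_ext := L.s_mem_extend
      ext_le := fun P hP Q h a ha =>
        L.mem_of_coeff_mem fun m => (mem_im P hP _).mp (h ((L.mem_extend Q a).mp ha m))
      le_ext := fun P hP Q h a ha =>
        (L.mem_extend Q a).mpr fun m => h ((mem_im P hP _).mpr (hcoeff P hP a ha m))
      stable_im := fun P hP g' b hb => by
        obtain ⟨g, hg⟩ := h₂ g'
        rw [mem_im P hP] at hb ⊢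
        rw [← hg]
        exact hP g _ hb
      stable_ext := fun Q hQ g a ha => by
        obtain ⟨g', t, hs, hu⟩ := h₁ g
        rw [mem_extend] at ha ⊢
        intro m
        rw [L.coeff_map (ρ g) (ρ' g') t hs hu]
        exact smul_mem_ideal _ (hQ g' _ (ha m))
      mul_mem := fun P hP I J h a ha b hb =>
        L.extend_mul_mem (fun x hx y hy => (mem_im P hP _).mp (h x hx y hy)) ha hb
      prime_ext := fun Q hQ => L.isPrimeIdeal_extend hQ }

end LaurentSplitting

end LaurentStable

end QuantumMatrix

namespace QuantumMatrix

/-! ### Multiplying the first row by a central element -/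

section RowScaling

variable {k : Type*} [Field k] {m n : ℕ} {q : k} {R S : Type*} [Ring R] [Algebra k R]
  [Ring S] [Algebra k S]

/-- The matrix obtained from `X` by multiplying its first row by `z`. -/
def scaleRow (z : R) (X : Fin (m + 1) → Fin (m + 1) → R) (i j : Fin (m + 1)) : R :=
  (if i = 0 then z else 1) * X i j

lemma map_scaleRow (f : R →ₐ[k] S) (z : R) (X : Fin (m + 1) → Fin (m + 1) → R)
    (i j : Fin (m + 1)) :
    f (scaleRow z X i j) = scaleRow (f z) (fun i j => f (X i j)) i j := by
  simp [scaleRow, apply_ite f]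

lemma scaleRow_scaleRow (z w : R) (X : Fin (m + 1) → Fin (m + 1) → R) :
    scaleRow z (scaleRow w X) = scaleRow (z * w) X := by
  ext i j
  simp only [scaleRow]
  split_ifs <;> simp [mul_assoc]

lemma scaleRow_one (X : Fin (m + 1) → Fin (m + 1) → R) : scaleRow 1 X = X := by
  ext i j
  simp [scaleRow]

/-- All monomials of a defining relation involve the same pair of rows, so a common factor comes out
of each relation. -/
lemma scaleRow_rel {z : R} {X : Fin (m + 1) → Fin (m + 1) → R}
    (hz : ∀ i j, Commute z (X i j)) (hX : ∀ a b, MRel q X a b → a = b) (a b : R)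
    (h : MRel q (scaleRow z X) a b) : a = b := by
  have key : ∀ i j l r, scaleRow z X i j * scaleRow z X l r =
      (if i = 0 then z else 1) * (if l = 0 then z else 1) * (X i j * X l r) := by
    intro i j l r
    have hc : Commute (X i j) (if l = 0 then z else 1) := by
      split_ifs
      · exact (hz i j).symm
      · exact Commute.one_right _
    simp only [scaleRow]
    rw [mul_assoc, ← mul_assoc (X i j), hc.eq]
    simp only [mul_assoc]
  have key' : ∀ i j l r, scaleRow z X l j * scaleRow z X i r =
      (if i = 0 then z else 1) * (if l = 0 then z else 1) * (X l j * X i r) := by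
    intro i j l r
    rw [key]
    congr 1
    split_ifs <;> simp
  cases h with
  | col i l j hil => rw [key, key', hX _ _ (MRel.col i l j hil), mul_smul_comm]
  | row i j r hjr => rw [key, key, hX _ _ (MRel.row i j r hjr), mul_smul_comm]
  | anti i l j r hil hrj => rw [key, key', hX _ _ (MRel.anti i l j r hil hrj)]
  | diag i l j r hil hjr =>
    rw [key, key', key, ← mul_sub, hX _ _ (MRel.diag i l j r hil hjr), mul_smul_comm]

/-- Each term of the determinant starts with its only entry from the first row, so `z` comes out on
the left without commuting past anything. -/
lemma qdet_scaleRow (z : R) (X : Fin (m + 1) → Fin (m + 1) → R) :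
    qdet q (scaleRow z X) = z * qdet q X := by
  rw [qdet, qdet, Finset.mul_sum]
  refine Finset.sum_congr rfl fun σ _ => ?_
  rw [mul_smul_comm]
  simp [List.ofFn_succ, scaleRow, mul_assoc]

end RowScaling

/-! ### The Laurent presentation of $\mathcal O_q(GL_n)$ and the torus actions -/

section GeneralLinear

variable {k : Type*} [Field k] {m n : ℕ} {q : k}

lemma OqGL.commute_qdet (hq : q ≠ 0) (hroot : ∀ m : ℕ, 0 < m → q ^ m ≠ 1) (a : OqGL n q) :
    Commute (qdet q (OqGL.X (n := n) q)) a := by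
  -- Conjugation by the determinant is an endomorphism fixing the generators $X_{ij}$, hence the
  -- identity.
  let f : OqGL n q →ₐ[k] OqGL n q :=
    { toFun := fun a => qdet q (OqGL.X q) * a * OqGL.Dinv n q
      map_one' := by rw [mul_one, OqGL.det_mul_Dinv]
      map_mul' := fun a b => by
        simp only [mul_assoc]
        rw [← mul_assoc (OqGL.Dinv n q), OqGL.Dinv_mul_det, one_mul]
      map_zero' := by simp
      map_add' := fun a b => by rw [mul_add, add_mul]
      commutes' := fun r => by
        rw [← Algebra.commutes, mul_assoc, OqGL.det_mul_Dinv, mul_one] }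
  have hf : f = AlgHom.id k _ := OqGL.hom_ext fun i j => by
    change qdet q (OqGL.X q) * OqGL.X q i j * OqGL.Dinv n q = OqGL.X q i j
    rw [(qdet_commute hq hroot OqGL.X_rel i j).eq, mul_assoc, OqGL.det_mul_Dinv, mul_one]
  have h := congrArg (· * qdet q (OqGL.X q)) (AlgHom.congr_fun hf a)
  change qdet q (OqGL.X q) * a * OqGL.Dinv n q * qdet q (OqGL.X q) = a * qdet q (OqGL.X q) at h
  rwa [mul_assoc, OqGL.Dinv_mul_det, mul_one] at h

/-- The quantum determinant as a unit. -/
noncomputable def OqGL.detUnit (n : ℕ) (q : k) : (OqGL n q)ˣ :=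
  ⟨qdet q (OqGL.X q), OqGL.Dinv n q, OqGL.det_mul_Dinv, OqGL.Dinv_mul_det⟩

lemma OqGL.commute_Dinv (hq : q ≠ 0) (hroot : ∀ m : ℕ, 0 < m → q ^ m ≠ 1) (a : OqGL n q) :
    Commute (OqGL.Dinv n q) a :=
  (Commute.units_inv_left (u := OqGL.detUnit n q) (OqGL.commute_qdet hq hroot a) :)

/-- The embedding of `OqSL` into `OqGL` which multiplies the first row by `D_q⁻¹`. -/
noncomputable def OqSL.toGL (hq : q ≠ 0) (hroot : ∀ m : ℕ, 0 < m → q ^ m ≠ 1) :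
    OqSL (m + 1) q →ₐ[k] OqGL (m + 1) q :=
  OqSL.lift (scaleRow (OqGL.Dinv (m + 1) q) (OqGL.X q))
    (scaleRow_rel (fun _ _ => OqGL.commute_Dinv hq hroot _) OqGL.X_rel)
    (by rw [qdet_scaleRow, OqGL.Dinv_mul_det])

lemma OqSL.toGL_x (hq : q ≠ 0) (hroot : ∀ m : ℕ, 0 < m → q ^ m ≠ 1) (i j : Fin (m + 1)) :
    OqSL.toGL hq hroot (OqSL.x q i j) = scaleRow (OqGL.Dinv (m + 1) q) (OqGL.X q) i j :=
  OqSL.lift_x _ _ _ _ _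

open LaurentPolynomial in
lemma OqSL.C_x_rel (a b : (OqSL (m + 1) q)[T;T⁻¹])
    (h : MRel q (fun i j => C (OqSL.x q i j)) a b) : a = b :=
  MRel.eq_of_map (X := OqSL.x q)
    (AddMonoidAlgebra.singleZeroAlgHom : OqSL (m + 1) q →ₐ[k] (OqSL (m + 1) q)[T;T⁻¹])
    (fun _ _ h => congrArg _ (OqSL.x_rel _ _ h)) a b h

open LaurentPolynomial in
lemma OqSL.qdet_scaleRow_T : qdet q (scaleRow (T 1) fun i j =>
    (C (OqSL.x q i j) : (OqSL (m + 1) q)[T;T⁻¹])) = T 1 := by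
  have h := map_qdet q (OqSL.x q)
    (AddMonoidAlgebra.singleZeroAlgHom : OqSL (m + 1) q →ₐ[k] (OqSL (m + 1) q)[T;T⁻¹])
  rw [OqSL.qdet_x, map_one] at h
  rw [qdet_scaleRow]
  exact (congrArg (T 1 * ·) h.symm).trans (mul_one _)

open LaurentPolynomial in
/-- The map to Laurent polynomials which multiplies the first row by the variable. -/
noncomputable def OqGL.toLaurent (m : ℕ) (q : k) :
    OqGL (m + 1) q →ₐ[k] (OqSL (m + 1) q)[T;T⁻¹] :=
  OqGL.lift (scaleRow (T 1) fun i j => C (OqSL.x q i j))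
    (scaleRow_rel (fun _ _ => commute_T _ _) OqSL.C_x_rel) (T (-1))
    (by rw [OqSL.qdet_scaleRow_T, ← T_add]; simp) (by rw [OqSL.qdet_scaleRow_T, ← T_add]; simp)

open LaurentPolynomial in
lemma OqGL.toLaurent_X (i j : Fin (m + 1)) : OqGL.toLaurent m q (OqGL.X q i j) =
    scaleRow (T 1) (fun i j => C (OqSL.x q i j)) i j :=
  OqGL.lift_X _ _ _ _ _ _ _

open LaurentPolynomial in
lemma OqGL.toLaurent_Dinv : OqGL.toLaurent m q (OqGL.Dinv (m + 1) q) = T (-1) :=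
  OqGL.lift_Dinv _ _ _ _ _

open LaurentPolynomial in
/-- `OqGL` as a Laurent polynomial ring over `OqSL`. -/
noncomputable def OqGL.splitting (m : ℕ) (hq : q ≠ 0) (hroot : ∀ m : ℕ, 0 < m → q ^ m ≠ 1) :
    LaurentSplitting k (OqGL (m + 1) q) (OqSL (m + 1) q) where
  s := OqSL.toGL hq hroot
  u := OqGL.detUnit (m + 1) q
  toLaurent := OqGL.toLaurent m q
  toLaurent_s b := by
    have h : (OqGL.toLaurent m q).comp (OqSL.toGL hq hroot) =
        AddMonoidAlgebra.singleZeroAlgHom := OqSL.hom_ext fun i j => by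
      rw [AlgHom.comp_apply, OqSL.toGL_x, map_scaleRow, OqGL.toLaurent_Dinv,
        show (fun i j => OqGL.toLaurent m q (OqGL.X q i j)) = _ from
          funext₂ OqGL.toLaurent_X]
      rw [scaleRow_scaleRow, ← T_add]
      simp only [neg_add_cancel, T_zero, scaleRow_one]
      rfl
    exact AlgHom.congr_fun h b
  toLaurent_u := by
    have h := congrArg (OqGL.toLaurent m q) (OqGL.det_mul_Dinv (n := m + 1) (q := q))
    rw [map_mul, OqGL.toLaurent_Dinv, map_one] at h
    have h' := congrArg (· * (T 1 : (OqSL (m + 1) q)[T;T⁻¹])) h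
    rw [mul_assoc, ← T_add, one_mul] at h'
    have h'' : OqGL.toLaurent m q (qdet q (OqGL.X q)) = T 1 := by simpa using h'
    exact h''
  injective := by
    -- A left inverse, sending $T$ to $D_q$: it undoes the scaling of the first row by $D_q^{-1}$.
    let ψ : (OqSL (m + 1) q)[T;T⁻¹] →ₐ[k] OqGL (m + 1) q :=
      AddMonoidAlgebra.liftNCAlgHom (OqSL.toGL hq hroot)
        ((Units.coeHom _).comp (zpowersHom _ (OqGL.detUnit (m + 1) q))) fun x y =>
          (Commute.units_zpow_right
            (OqGL.commute_qdet hq hroot (OqSL.toGL hq hroot x)).symm _ :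
              Commute _ ((OqGL.detUnit (m + 1) q ^ y.toAdd : (OqGL (m + 1) q)ˣ) : OqGL (m + 1) q))
    have hψ : ∀ b r, ψ (.single r b) = OqSL.toGL hq hroot b *
        ((OqGL.detUnit (m + 1) q ^ r : (OqGL (m + 1) q)ˣ) : OqGL (m + 1) q) := fun b r =>
      AddMonoidAlgebra.liftNC_single _ _ _ _
    have hψC : ∀ b, ψ (C b) = OqSL.toGL hq hroot b := fun b => by
      rw [← single_eq_C, hψ, zpow_zero, Units.val_one, mul_one]
    have hψT : ψ (T 1) = qdet q (OqGL.X q) := by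
      rw [T, hψ, map_one, one_mul, zpow_one]
      rfl
    have h : ψ.comp (OqGL.toLaurent m q) = AlgHom.id k _ := OqGL.hom_ext fun i j => by
      rw [AlgHom.comp_apply, OqGL.toLaurent_X, map_scaleRow, hψT]
      simp only [hψC]
      rw [show (fun i j => OqSL.toGL hq hroot (OqSL.x q i j)) = _ from
        funext₂ (OqSL.toGL_x hq hroot), scaleRow_scaleRow, OqGL.det_mul_Dinv, scaleRow_one]
      rfl
    exact Function.LeftInverse.injective (g := ψ) fun a => AlgHom.congr_fun h a

lemma OqGL.toSL_X (i j : Fin n) : OqGL.toSL n q (OqGL.X q i j) = OqSL.x q i j :=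
  OqGL.lift_X _ _ _ _ _ _ _

lemma OqGL.toSL_Dinv : OqGL.toSL n q (OqGL.Dinv n q) = 1 := OqGL.lift_Dinv _ _ _ _ _

lemma OqGL.toSL_toGL (hq : q ≠ 0) (hroot : ∀ m : ℕ, 0 < m → q ^ m ≠ 1) (b : OqSL (m + 1) q) :
    OqGL.toSL (m + 1) q (OqSL.toGL hq hroot b) = b := by
  have h : (OqGL.toSL (m + 1) q).comp (OqSL.toGL hq hroot) = AlgHom.id k _ :=
    OqSL.hom_ext fun i j => by
      rw [AlgHom.comp_apply, OqSL.toGL_x, map_scaleRow, OqGL.toSL_Dinv, scaleRow_one, OqGL.toSL_X]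
      rfl
  exact AlgHom.congr_fun h b

lemma OqGL.torusAction_qdet (h : H n k) : OqGL.torusAction n q h (qdet q (OqGL.X q)) =
    (detChar n k h : k) • qdet q (OqGL.X q) := by
  rw [← qdet_torus]
  refine (map_qdet q _ (OqGL.torusAction n q h : OqGL n q →ₐ[k] OqGL n q)).trans ?_
  congr 1
  ext i j
  exact OqGL.torusAction_X h i j

lemma OqGL.torusAction_Dinv (h : H n k) : OqGL.torusAction n q h (OqGL.Dinv n q) =
    ((detChar n k h)⁻¹ : kˣ) • OqGL.Dinv n q := by
  refine left_inv_eq_right_inv (a := OqGL.torusAction n q h (qdet q (OqGL.X q))) ?_ ?_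
  · rw [← map_mul, OqGL.Dinv_mul_det, map_one]
  · rw [OqGL.torusAction_qdet, Units.smul_def, smul_mul_smul_comm, OqGL.det_mul_Dinv]
    simp

/-- The one-parameter subgroup of `H` acting on the first row. -/
def rowCocharacter (m : ℕ) (t : kˣ) : H (m + 1) k := (Pi.mulSingle 0 t, 1)

lemma detChar_rowCocharacter (t : kˣ) : detChar (m + 1) k (rowCocharacter m t) = t := by
  simp [detChar, rowCocharacter]

/-- On the first row $D_q^{-1}X_{1j}$ of the embedded copy, the determinant character contributed by
$D_q^{-1}$ cancels the row cocharacter in `h`, so only `σ` acts. -/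
lemma OqGL.torusAction_toGL (hq : q ≠ 0) (hroot : ∀ m : ℕ, 0 < m → q ^ m ≠ 1)
    (h : H (m + 1) k) (σ : SH (m + 1) k)
    (hσ : h = σ.1 * rowCocharacter m (detChar (m + 1) k h)) (b : OqSL (m + 1) q) :
    OqGL.torusAction (m + 1) q h (OqSL.toGL hq hroot b) =
      OqSL.toGL hq hroot (OqSL.torusAction (m + 1) q σ b) := by
  have key : (OqGL.torusAction (m + 1) q h : OqGL (m + 1) q →ₐ[k] OqGL (m + 1) q).comp
      (OqSL.toGL hq hroot) = (OqSL.toGL hq hroot).comp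
        (OqSL.torusAction (m + 1) q σ : OqSL (m + 1) q →ₐ[k] OqSL (m + 1) q) := by
    refine OqSL.hom_ext fun i j => ?_
    change OqGL.torusAction (m + 1) q h (OqSL.toGL hq hroot (OqSL.x q i j)) =
      OqSL.toGL hq hroot (OqSL.torusAction (m + 1) q σ (OqSL.x q i j))
    simp only [OqSL.torusAction_x, map_smul, OqSL.toGL_x,
      scaleRow, map_mul, OqGL.torusAction_X, apply_ite (OqGL.torusAction (m + 1) q h), map_one,
      OqGL.torusAction_Dinv]
    have h1 : (h.1 i : kˣ) = σ.1.1 i * (Pi.mulSingle 0 (detChar (m + 1) k h) : _ → kˣ) i :=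
      congrFun (congrArg Prod.fst hσ) i
    have h2 : h.2 j = σ.1.2 j := by
      simpa [rowCocharacter] using congrFun (congrArg Prod.snd hσ) j
    rw [h1, h2]
    split_ifs with hi
    · subst hi
      rw [Pi.mulSingle_eq_same, Units.smul_def, smul_mul_smul_comm]
      congr 1
      simp
      field_simp
    · simp [Pi.mulSingle_eq_of_ne hi]
  exact AlgHom.congr_fun key b

lemma stableCorrespondence_succ (m : ℕ) (hq : q ≠ 0) (hroot : ∀ m : ℕ, 0 < m → q ^ m ≠ 1) :
    StableCorrespondence (OqGL.torusAction (m + 1) q) (OqSL.torusAction (m + 1) q)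
      (OqSL.toGL hq hroot) OqGL.imageIdeal (OqGL.splitting m hq hroot).extend := by
  refine (OqGL.splitting m hq hroot).stableCorrespondence (OqGL.toSL (m + 1) q)
    (OqGL.toSL_toGL hq hroot) ?_ _ OqGL.mem_imageIdeal ?_ ?_ ?_
  · change OqGL.toSL (m + 1) q (qdet q (OqGL.X q)) = 1
    rw [map_qdet]
    simp only [OqGL.toSL_X]
    exact OqSL.qdet_x
  · intro h
    have hσ : h * (rowCocharacter m (detChar (m + 1) k h))⁻¹ ∈ SH (m + 1) k := by
      rw [SH, MonoidHom.mem_ker, map_mul, map_inv, detChar_rowCocharacter, mul_inv_cancel]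
    exact ⟨⟨_, hσ⟩, detChar (m + 1) k h,
      OqGL.torusAction_toGL hq hroot h ⟨_, hσ⟩ (by simp), OqGL.torusAction_qdet h⟩
  · intro σ
    have hdet : detChar (m + 1) k σ = 1 := MonoidHom.mem_ker.mp σ.2
    refine ⟨σ.1, OqGL.torusAction_toGL hq hroot σ.1 σ ?_⟩
    rw [hdet]
    simp [rowCocharacter]
  -- The parameter $q$ itself supplies a scalar of infinite order.
  · refine ⟨rowCocharacter m (Units.mk0 q hq), Units.mk0 q hq, ?_, fun b => ?_, ?_⟩
    · rw [injective_zpow_iff_not_isOfFinOrder, isOfFinOrder_iff_pow_eq_one]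
      rintro ⟨r, hr, h⟩
      exact hroot r hr (by simpa using congrArg Units.val h)
    · have := OqGL.torusAction_toGL hq hroot (rowCocharacter m (Units.mk0 q hq)) 1
        (by rw [detChar_rowCocharacter]; simp) b
      rwa [map_one] at this
    · have := OqGL.torusAction_qdet (q := q) (rowCocharacter m (Units.mk0 q hq))
      rwa [detChar_rowCocharacter] at this

lemma qdet_fin_zero {R : Type*} [Ring R] [Algebra k R] (X : Fin 0 → Fin 0 → R) :
    qdet q X = 1 := by
  rw [qdet, Fintype.sum_unique, permLength_eq_invNum]
  simp [invNum]

/-- There is no first row to scale, but also no generator $X_{ij}$, and the determinant is 1;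
algebra maps out of either ring are unique, so $\pi$ is an isomorphism and both actions are trivial.
-/
lemma stableCorrespondence_zero (q : k) : ∃ s ext,
    StableCorrespondence (OqGL.torusAction 0 q) (OqSL.torusAction 0 q) s OqGL.imageIdeal ext :=
  ⟨OqSL.lift (OqGL.X q) OqGL.X_rel (qdet_fin_zero _), _, .of_trivial _ (OqGL.toSL 0 q)
    (fun b => AlgHom.congr_fun (OqSL.hom_ext (f := (OqGL.toSL 0 q).comp _) (g := AlgHom.id k _)
      fun i => i.elim0) b)
    (fun a => AlgHom.congr_fun (OqGL.hom_ext (f := AlgHom.comp _ (OqGL.toSL 0 q))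
      (g := AlgHom.id k _) fun i => i.elim0) a)
    _ OqGL.mem_imageIdeal
    (fun g a => AlgHom.congr_fun (OqGL.hom_ext (f := (OqGL.torusAction 0 q g).toAlgHom)
      (g := AlgHom.id k _) fun i => i.elim0) a)
    (fun g b => AlgHom.congr_fun (OqSL.hom_ext (f := (OqSL.torusAction 0 q g).toAlgHom)
      (g := AlgHom.id k _) fun i => i.elim0) b)⟩

end GeneralLinear

end QuantumMatrix

theorem proposition2p4 {k : Type*} [Field k] (q : k) (hq : q ≠ 0)
    (hroot : ∀ m : ℕ, 0 < m → q ^ m ≠ 1) (n : ℕ) :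
    Set.BijOn (fun P : TwoSidedIdeal (QuantumMatrix.OqGL n q) => QuantumMatrix.OqGL.imageIdeal P)
      {P | QuantumMatrix.IsGPrime (QuantumMatrix.OqGL.torusAction n q) P}
      {Q | QuantumMatrix.IsGPrime (QuantumMatrix.OqSL.torusAction n q) Q} ∧
    Set.BijOn (fun P : TwoSidedIdeal (QuantumMatrix.OqGL n q) => QuantumMatrix.OqGL.imageIdeal P)
      {P | QuantumMatrix.IsPrimeIdeal P ∧
        QuantumMatrix.IsStable (QuantumMatrix.OqGL.torusAction n q) P}
      {Q | QuantumMatrix.IsPrimeIdeal Q ∧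
        QuantumMatrix.IsStable (QuantumMatrix.OqSL.torusAction n q) Q} := by
  obtain _ | m := n
  · obtain ⟨s, ext, c⟩ := QuantumMatrix.stableCorrespondence_zero q
    exact ⟨c.bijOn_isGPrime, c.bijOn_isPrimeIdeal⟩
  · have c := QuantumMatrix.stableCorrespondence_succ m hq hroot
    exact ⟨c.bijOn_isGPrime, c.bijOn_isPrimeIdeal⟩
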